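/- Let $k\ge 1$, let $Z$ be a standard Gaussian random vector in $\mathbb{R}^k$, and write $|\cdot|$ for the Euclidean norm. For random vectors $X,Y$ in $\mathbb{R}^k$ put \[ d_1(X,Y)=\sup\big\{|\mathbb{E}f(X)-\mathbb{E}f(Y)| : f:\mathbb{R}^k\to\mathbb{R},\ |f(x)-f(y)|\le|x-y| \text{ for all } x,y\big\} \] ($X$, $Y$ integrable) and \[ d_{TV}(X,Y)=2\sup\big\{|\mathbb{P}[X\in A]-\mathbb{P}[Y\in A]| : A\subseteq\mathbb{R}^k \text{ measurable}\big\}. \] There is an absolute constant $C>0$ (in particular independent of $k$, $\lambda$ and all the distributions involved) such that the following holds. Let $W$ and $W'$ be identically distributed random vectors in $\mathbb{R}^k$, defined on a common probability space, with $\mathbb{E}|W'-W|^2<\infty$. Suppose that for some constant $\lambda>0$ and random variables $E_{ij}$, $1\le i,j\le k$, almost surely \begin{align*} \mathbb{E}\big[W'_i-W_i\,\big|\,W\big]&=-\lambda W_i,\\ \mathbb{E}\big[(W'_i-W_i)(W'_j-W_j)\,\big|\,W\big]&=2\lambda\delta_{ij}+E_{ij} \end{align*} for all $1\le i,j\le k$.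 Then \[ d_1(W,Z)\le\frac1\lambda\,\mathbb{E}\sqrt{\sum_{i,j=1}^kE_{ij}^2}+k^{1/4}\sqrt{\frac{2}{3\lambda}\,\mathbb{E}|W'-W|^3}. \] If moreover $W$ is log-concave, that is, the distribution of $W$ has a density $f\ge0$ with respect to Lebesgue measure on $\mathbb{R}^k$ such that $f(ax+by)\ge f(x)^af(y)^b$ for all $x,y\in\mathbb{R}^k$ and all $a,b>0$ with $a+b=1$, then \[ d_{TV}(W,Z)\le C\left(\frac{k}{\lambda}\,\mathbb{E}\sqrt{\sum_{i,j=1}^kE_{ij}^2}+\frac{k^2}{\lambda}\,\mathbb{E}|W'-W|^3\right)^{1/3}. \] (If $\mathbb{E}|W'-W|^3=\infty$, the right-hand sides are understood as $+\infty$.) -/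

import Mathlib

open MeasureTheory ProbabilityTheory
open scoped ENNReal NNReal

noncomputable section

/-- The `L¹`-Wasserstein distance of two probability measures with finite first moment: the supremum
of `|∫ f dμ - ∫ f dν|` over all real functions `f` with `|f x - f y| ≤ dist x y`. -/
def wassersteinDist {X : Type*} [PseudoMetricSpace X] [MeasurableSpace X] (μ ν : Measure X) : ℝ≥0∞ :=
  ⨆ (f : X → ℝ) (_ : LipschitzWith 1 f), ENNReal.ofReal |∫ x, f x ∂μ - ∫ x, f x ∂ν|

/-- The total variation distance of two probability measures, normalized so that its largest value
is `2`: twice the supremum of `|μ A - ν A|` over all measurable sets `A`. -/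
def totalVariationDist {X : Type*} [MeasurableSpace X] (μ ν : Measure X) : ℝ≥0∞ :=
  2 * ⨆ (A : Set X) (_ : MeasurableSet A), ENNReal.ofReal |μ.real A - ν.real A|

/-- A nonnegative function `f` is log-concave if `f (a x + b y) ≥ f x ^ a * f y ^ b` for all points
`x`, `y` and all weights `a, b > 0` with `a + b = 1`. -/
def IsLogConcaveFun {X : Type*} [AddCommGroup X] [Module ℝ X] (f : X → ℝ) : Prop :=
  (∀ x, 0 ≤ f x) ∧
    ∀ x y : X, ∀ a b : ℝ, 0 < a → 0 < b → a + b = 1 → f x ^ a * f y ^ b ≤ f (a • x + b • y)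

/-- A measure is log-concave if it has a log-concave density with respect to Lebesgue measure. -/
def IsLogConcaveMeasure {X : Type*} [AddCommGroup X] [Module ℝ X] [MeasureSpace X]
    (μ : Measure X) : Prop :=
  ∃ f : X → ℝ, Measurable f ∧ IsLogConcaveFun f ∧
    μ = (volume : Measure X).withDensity fun x => ENNReal.ofReal (f x)

end

/-!
The proof rests on one comparison. Let `Z` be a standard Gaussian vector independent of `W`, and let
`f` be a smooth test function. The function `r ↦ 𝔼 f (r W + √(1 - r² + t²) Z)` on `[0, 1]`
interpolates between `𝔼 f (√(1 + t²) Z)` and `𝔼 f (W + t Z)` (`interp`). After a Gaussian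
integration by parts, its derivative at `r` is `-1 / r` times `𝔼 (Δu (W) - W · ∇u (W))`, where
`u (x)` is the Gaussian average of `f` around `r x` with standard deviation `σ = √(1 - r² + t²)`
(`hasDerivAt_interp`). Since `W` and `W'` have the same law, `𝔼 u (W') = 𝔼 u (W)`; Taylor expansion
of order two and the conditional moments of `W' - W` given `W` turn this identity into a bound for
`𝔼 (Δu (W) - W · ∇u (W))` by the Hilbert–Schmidt norm of the Hessian of `u`, multiplied by the error
`E`, and its third derivatives, multiplied by `𝔼 |W' - W|³`
(`IsSteinPair.abs_integral_stein_le`). Gaussian averaging makes these derivatives of `u` explicit: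
each derivative moved from `f` to the Gaussian density costs the inverse of a standard deviation,
and for the Hessian this holds in Hilbert–Schmidt norm without loss in the dimension
(`sum_sq_gaussianSmooth_fderiv_le`). Integration over `r` compares `𝔼 f (W + t Z)` with
`𝔼 f (√(1 + t²) Z)`, for `f` Lipschitz as well as for `f` bounded.

For Lipschitz `f`, removing the smoothing costs at most `2 t √k`, and the optimal choice of `t`
gives the bound in the Wasserstein distance (`IsSteinPair.abs_integral_sub_le`).

In total variation, smoothing is not harmless for a general law, and this is where log-concavity is
used. If the Wasserstein distance is not small, there is nothing to prove. If it is small, then the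
density of `W` at every point within `1 / 10` of the origin is at least `exp (-10 k)` times any of
its values: otherwise, a superlevel set of the density, which is convex and carries almost all the
mass, would lie in a half-space `{x | ⟪v, x⟫ ≤ 1 / 10}` with `‖v‖ = 1`, against the closeness to the
Gaussian law (`IsLogConcaveFun.exp_mul_le`). By log-concavity the law then nearly dominates its
images under the contractions `x ↦ (1 - τ) x + y` with `‖y‖ ≤ τ / 10`; comparing two of them shows
that a translation by `y` changes the law by at most `220 k ‖y‖` in total variation
(`IsLogConcaveFun.abs_integral_comp_add_sub_le`). Averaging over `y = t Z` bounds the cost of the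
smoothing by a multiple of `k ^ (3 / 2) t`, and `t` is chosen to balance this against the comparison
for bounded `f` (`IsSteinPair.abs_measureReal_sub_le`).
-/

open Filter Topology
open scoped RealInnerProductSpace

/-! ### Gaussian averages -/

section BddC1

variable {E : Type*} [NormedAddCommGroup E] [InnerProductSpace ℝ E]

/-- A continuously differentiable function that is bounded together with its derivative. -/
structure BddC1 (F : E → ℝ) : Prop where
  contDiff : ContDiff ℝ 1 F
  bdd : ∃ C, ∀ x, |F x| ≤ C
  bdd_fderiv : ∃ C, ∀ x, ‖fderiv ℝ F x‖ ≤ C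

/-- The directional derivative of `F` in the direction `v`, as a function of the base point. -/
noncomputable def dirDeriv (v : E) (F : E → ℝ) (x : E) : ℝ := fderiv ℝ F x v

namespace BddC1

lemma continuous {F : E → ℝ} (hF : BddC1 F) : Continuous F := hF.contDiff.continuous

lemma differentiable {F : E → ℝ} (hF : BddC1 F) : Differentiable ℝ F :=
  hF.contDiff.differentiable one_ne_zero

lemma continuous_fderiv {F : E → ℝ} (hF : BddC1 F) : Continuous (fderiv ℝ F) :=
  hF.contDiff.continuous_fderiv one_ne_zero

lemma comp_affine {F : E → ℝ} (hF : BddC1 F) (x : E) (σ : ℝ) :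
    BddC1 (fun z => F (x + σ • z)) ∧
      ∀ z v, fderiv ℝ (fun z => F (x + σ • z)) z v = σ * fderiv ℝ F (x + σ • z) v := by
  have hd : ∀ z : E, fderiv ℝ (fun z => F (x + σ • z)) z = σ • fderiv ℝ F (x + σ • z) := by
    intro z
    have h1 : HasFDerivAt (fun z : E => x + σ • z) (σ • ContinuousLinearMap.id ℝ E) z :=
      ((hasFDerivAt_id z).const_smul σ).const_add x
    have := ((hF.differentiable (x + σ • z)).hasFDerivAt.comp z h1).fderiv
    simp only [Function.comp_def] at this
    rw [this]
    ext w
    simp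
  obtain ⟨C, hC⟩ := hF.bdd
  obtain ⟨C', hC'⟩ := hF.bdd_fderiv
  refine ⟨⟨hF.contDiff.comp (by fun_prop), ⟨C, fun z => hC _⟩, ⟨|σ| * C', fun z => ?_⟩⟩, ?_⟩
  · rw [hd, norm_smul, Real.norm_eq_abs]
    gcongr
    exact hC' _
  · intro z v
    rw [hd]
    simp

lemma abs_sub_le {F : E → ℝ} (hF : BddC1 F) {L : ℝ} (hL : ∀ x v, |dirDeriv v F x| ≤ L * ‖v‖)
    (x y : E) : |F x - F y| ≤ L * ‖x - y‖ := by
  by_cases hL0 : 0 ≤ L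
  · exact Convex.norm_image_sub_le_of_norm_fderiv_le (f := F) (s := Set.univ) (𝕜 := ℝ)
      (fun z _ => hF.differentiable z)
      (fun z _ => ContinuousLinearMap.opNorm_le_bound _ hL0 (hL z)) convex_univ
      (Set.mem_univ y) (Set.mem_univ x)
  · by_cases hxy : x - y = 0
    · rw [sub_eq_zero.1 hxy]; simp
    · exfalso
      have h1 := hL x (x - y)
      have h2 : 0 < ‖x - y‖ := norm_pos_iff.2 hxy
      have := abs_nonneg (dirDeriv (x - y) F x)
      nlinarith

end BddC1

end BddC1

section GaussianSmoothing

variable {E : Type*} [NormedAddCommGroup E] [InnerProductSpace ℝ E] [FiniteDimensional ℝ E]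
  [MeasurableSpace E] [BorelSpace E]

lemma stdGaussian_eq_withDensity :
    stdGaussian E = (volume : Measure E).withDensity fun x => ENNReal.ofReal
      ((2 * Real.pi) ^ (-(Module.finrank ℝ E : ℝ) / 2) * Real.exp (-(1 / 2) * ‖x‖ ^ 2)) := by
  set c : ℝ := (2 * Real.pi) ^ (-(Module.finrank ℝ E : ℝ) / 2) with hc
  have hc0 : 0 < c := by positivity
  have hint : Integrable (fun x : E => c * Real.exp (-(1 / 2) * ‖x‖ ^ 2)) := by
    have h := (GaussianFourier.integrable_cexp_neg_mul_sq_norm_add (V := E) (b := (1 / 2 : ℂ))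
      (by norm_num) 0 0).norm
    refine (h.congr (ae_of_all _ fun x => ?_)).const_mul c
    simp [Complex.norm_exp, ← Complex.ofReal_pow]
  have hfin : IsFiniteMeasure ((volume : Measure E).withDensity fun x => ENNReal.ofReal
      (c * Real.exp (-(1 / 2) * ‖x‖ ^ 2))) :=
    isFiniteMeasure_withDensity_ofReal hint.2
  apply Measure.ext_of_charFun
  ext t
  rw [charFun_stdGaussian, charFun_apply,
    integral_withDensity_eq_integral_toReal_smul (by fun_prop) (ae_of_all _ fun _ => by simp)]
  have h := GaussianFourier.integral_cexp_neg_mul_sq_norm_add (V := E) (b := (1 / 2 : ℂ))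
      (by norm_num) Complex.I t
  have h2 : ∀ x : E, (ENNReal.ofReal (c * Real.exp (-(1 / 2) * ‖x‖ ^ 2))).toReal •
      Complex.exp (⟪x, t⟫ * Complex.I) =
      (c : ℂ) * Complex.exp (-(1 / 2) * ‖x‖ ^ 2 + Complex.I * ⟪t, x⟫) := by
    intro x
    rw [ENNReal.toReal_ofReal (by positivity), Complex.exp_add, real_inner_comm, Complex.real_smul]
    push_cast
    ring_nf
  simp_rw [h2]
  rw [integral_const_mul, h, hc, ← mul_assoc]
  have h3 : (((2 * Real.pi) ^ (-(Module.finrank ℝ E : ℝ) / 2) : ℝ) : ℂ) *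
      ((Real.pi : ℂ) / (1 / 2)) ^ ((Module.finrank ℝ E : ℂ) / 2) = 1 := by
    have : ((Real.pi : ℂ) / (1 / 2)) ^ ((Module.finrank ℝ E : ℂ) / 2) =
        (((2 * Real.pi) ^ ((Module.finrank ℝ E : ℝ) / 2) : ℝ) : ℂ) := by
      rw [Complex.ofReal_cpow (by positivity)]
      push_cast
      congr 1
      ring
    rw [this, ← Complex.ofReal_mul, ← Real.rpow_add (by positivity)]
    simp [neg_div]
  rw [h3, one_mul, Complex.I_sq]
  congr 1
  ring

lemma integral_stdGaussian_eq (F : E → ℝ) :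
    ∫ x, F x ∂stdGaussian E = ∫ x, F x *
      ((2 * Real.pi) ^ (-(Module.finrank ℝ E : ℝ) / 2) * Real.exp (-(1 / 2) * ‖x‖ ^ 2)) := by
  rw [stdGaussian_eq_withDensity,
    integral_withDensity_eq_integral_toReal_smul (by fun_prop) (ae_of_all _ fun _ => by simp)]
  congr 1
  ext x
  rw [ENNReal.toReal_ofReal (by positivity), smul_eq_mul, mul_comm]

lemma integrable_stdGaussian_iff (F : E → ℝ) :
    Integrable F (stdGaussian E) ↔ Integrable fun x => F x *
      ((2 * Real.pi) ^ (-(Module.finrank ℝ E : ℝ) / 2) * Real.exp (-(1 / 2) * ‖x‖ ^ 2)) := by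
  rw [stdGaussian_eq_withDensity,
    integrable_withDensity_iff_integrable_smul' (by fun_prop) (ae_of_all _ fun _ => by simp)]
  refine integrable_congr (ae_of_all _ fun x => ?_)
  simp only
  rw [ENNReal.toReal_ofReal (by positivity), smul_eq_mul, mul_comm]

lemma integrable_norm_stdGaussian : Integrable (fun z : E => ‖z‖) (stdGaussian E) :=
  (IsGaussian.integrable_id (μ := stdGaussian E)).norm

lemma integrable_inner_stdGaussian (v : E) : Integrable (fun z : E => ⟪v, z⟫) (stdGaussian E) :=
  IsGaussian.integrable_dual (stdGaussian E) (innerSL ℝ v)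

/-- Gaussian integration by parts. -/
lemma integral_mul_inner_stdGaussian {F : E → ℝ} (hF : BddC1 F) (v : E) :
    ∫ z, F z * ⟪v, z⟫ ∂stdGaussian E = ∫ z, fderiv ℝ F z v ∂stdGaussian E := by
  obtain ⟨C, hC⟩ := hF.bdd
  obtain ⟨C', hC'⟩ := hF.bdd_fderiv
  have hdiff : Differentiable ℝ F := hF.contDiff.differentiable one_ne_zero
  set c : ℝ := (2 * Real.pi) ^ (-(Module.finrank ℝ E : ℝ) / 2) with hc
  set g : E → ℝ := fun x => c * Real.exp (-(1 / 2) * ‖x‖ ^ 2) with hg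
  have hgd : ∀ x, HasFDerivAt g (-(g x) • innerSL ℝ x) x := by
    intro x
    have h1 : HasFDerivAt (fun x : E => ‖x‖ ^ 2) (2 • (innerSL ℝ x)) x :=
      (hasStrictFDerivAt_norm_sq x).hasFDerivAt
    have h2 := ((h1.const_mul (-(1 / 2) : ℝ)).exp).const_mul c
    refine h2.congr_fderiv ?_
    ext w
    simp [hg]
    ring
  have i1 : Integrable (fun z => fderiv ℝ F z v) (stdGaussian E) := by
    refine Integrable.of_bound (C := C' * ‖v‖) ?_ (ae_of_all _ fun z => ?_)
    · exact ((hF.contDiff.continuous_fderiv one_ne_zero).clm_apply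
        continuous_const).aestronglyMeasurable
    · exact (ContinuousLinearMap.le_opNorm _ _).trans (by gcongr; exact hC' z)
  have i0 : Integrable F (stdGaussian E) :=
    Integrable.of_bound (C := C) hF.contDiff.continuous.aestronglyMeasurable (ae_of_all _ hC)
  have i2 : Integrable (fun z => F z * ⟪v, z⟫) (stdGaussian E) :=
    (integrable_inner_stdGaussian v).bdd_mul hF.contDiff.continuous.aestronglyMeasurable
      (ae_of_all _ hC)
  have hgv : ∀ x, fderiv ℝ g x v = -(g x) * ⟪v, x⟫ := by
    intro x
    rw [(hgd x).fderiv, real_inner_comm]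
    simp
  rw [integral_stdGaussian_eq, integral_stdGaussian_eq]
  have := integral_mul_fderiv_eq_neg_fderiv_mul_of_integrable
    (μ := (volume : Measure E)) (f := F) (g := g) (v := v)
    ((integrable_stdGaussian_iff _).1 i1) ?_ ((integrable_stdGaussian_iff _).1 i0)
    (fun x _ => hdiff x) (fun x _ => (hgd x).differentiableAt)
  · rw [← neg_inj, ← this, ← integral_neg]
    refine integral_congr_ae (ae_of_all _ fun x => ?_)
    simp only [hgv]
    simp only [hg]
    ring
  · refine ((integrable_stdGaussian_iff _).1 i2).neg.congr (ae_of_all _ fun x => ?_)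
    simp only [hgv, Pi.neg_apply]
    simp only [hg]
    ring

lemma integral_abs_gaussianReal :
    ∫ x, |x| ∂gaussianReal 0 1 = √(2 / Real.pi) := by
  rw [integral_gaussianReal_eq_integral_smul one_ne_zero]
  have h := integral_comp_abs (f := fun x => (√(2 * Real.pi))⁻¹ * (x * Real.exp (-x ^ 2 / 2)))
  have h0 : ∀ x : ℝ, gaussianPDFReal 0 1 x • |x| =
      (√(2 * Real.pi))⁻¹ * (|x| * Real.exp (-|x| ^ 2 / 2)) := by
    intro x
    rw [gaussianPDFReal_def]
    simp
    ring
  simp_rw [h0]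
  rw [h, integral_const_mul]
  have h2 := integral_rpow_mul_exp_neg_mul_rpow (p := 2) (q := 1) (b := 1 / 2) (by norm_num)
    (by norm_num) (by norm_num)
  have h3 : ∫ x in Set.Ioi (0 : ℝ), x * Real.exp (-x ^ 2 / 2) = 1 := by
    have e : ∀ x : ℝ, x ^ (1 : ℝ) * Real.exp (-(1 / 2) * x ^ (2 : ℝ)) =
        x * Real.exp (-x ^ 2 / 2) := by
      intro x
      rw [Real.rpow_one, Real.rpow_two]
      congr 2
      ring
    simp_rw [e] at h2
    rw [h2]
    norm_num
  rw [h3, Real.sqrt_div (by norm_num), Real.sqrt_mul (by norm_num)]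
  field_simp
  norm_num

lemma map_inner_stdGaussian (v : E) :
    (stdGaussian E).map (fun z => ⟪v, z⟫) = gaussianReal 0 (‖v‖₊ ^ 2) := by
  have h := IsGaussian.map_eq_gaussianReal (μ := stdGaussian E) (innerSL ℝ v)
  rw [integral_strongDual_stdGaussian, variance_dual_stdGaussian, innerSL_apply_norm] at h
  have : (‖v‖ ^ 2).toNNReal = ‖v‖₊ ^ 2 := by
    rw [Real.toNNReal_pow (norm_nonneg _), norm_toNNReal]
  rw [← this]
  exact h

lemma integral_abs_inner_stdGaussian (v : E) :
    ∫ z, |⟪v, z⟫| ∂stdGaussian E = √(2 / Real.pi) * ‖v‖ := by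
  have h1 : gaussianReal 0 (‖v‖₊ ^ 2) = (gaussianReal 0 1).map (‖v‖ * ·) := by
    rw [gaussianReal_map_const_mul]
    congr 1
    · simp
    · ext; simp
  have h2 : ∫ z, |⟪v, z⟫| ∂stdGaussian E = ∫ x, |x| ∂gaussianReal 0 (‖v‖₊ ^ 2) := by
    rw [← map_inner_stdGaussian, integral_map (by fun_prop) (by fun_prop)]
  rw [h2, h1, integral_map (by fun_prop) (by fun_prop)]
  simp_rw [abs_mul, abs_norm]
  rw [integral_const_mul, integral_abs_gaussianReal, mul_comm]

lemma integrable_inner_mul_inner_stdGaussian (v w : E) :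
    Integrable (fun z : E => ⟪v, z⟫ * ⟪w, z⟫) (stdGaussian E) :=
  (IsGaussian.memLp_dual (stdGaussian E) (innerSL ℝ v) 2 (by simp)).integrable_mul
    (IsGaussian.memLp_dual (stdGaussian E) (innerSL ℝ w) 2 (by simp))

lemma integral_inner_mul_inner_stdGaussian (v w : E) :
    ∫ z, ⟪v, z⟫ * ⟪w, z⟫ ∂stdGaussian E = ⟪v, w⟫ := by
  have h := covarianceBilin_stdGaussian (E := E)
  have h2 := covarianceBilin_apply_eq_cov (μ := stdGaussian E) IsGaussian.memLp_two_id v w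
  rw [h] at h2
  rw [covariance_eq_sub] at h2
  · have h3 := integral_strongDual_stdGaussian (innerSL ℝ v)
    simp only [innerSL_apply_apply] at h2 h3
    rw [h3] at h2
    rw [innerSL_apply_apply] at h2
    simpa using h2.symm
  · exact IsGaussian.memLp_dual (stdGaussian E) (innerSL ℝ v) 2 (by simp)
  · exact IsGaussian.memLp_dual (stdGaussian E) (innerSL ℝ w) 2 (by simp)

lemma integral_sq_norm_stdGaussian {k : ℕ} :
    Integrable (fun z => ‖z‖ ^ 2) (stdGaussian (EuclideanSpace ℝ (Fin k))) ∧
    ∫ z, ‖z‖ ^ 2 ∂stdGaussian (EuclideanSpace ℝ (Fin k)) = k := by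
  have h : ∀ z : EuclideanSpace ℝ (Fin k), ‖z‖ ^ 2 =
      ∑ i, ⟪EuclideanSpace.single i (1 : ℝ), z⟫ * ⟪EuclideanSpace.single i (1 : ℝ), z⟫ := by
    intro z
    rw [EuclideanSpace.real_norm_sq_eq]
    simp [sq, EuclideanSpace.inner_single_left]
  simp_rw [h]
  refine ⟨integrable_finsetSum _ fun i _ => integrable_inner_mul_inner_stdGaussian _ _, ?_⟩
  rw [integral_finsetSum _ fun i _ => integrable_inner_mul_inner_stdGaussian _ _]
  simp_rw [integral_inner_mul_inner_stdGaussian]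
  simp

lemma integral_norm_stdGaussian_le {k : ℕ} :
    ∫ z, ‖z‖ ∂stdGaussian (EuclideanSpace ℝ (Fin k)) ≤ √k := by
  obtain ⟨hi, h2⟩ := integral_sq_norm_stdGaussian (k := k)
  set m := ∫ z, ‖z‖ ∂stdGaussian (EuclideanSpace ℝ (Fin k)) with hm
  have h : 0 ≤ ∫ z, (‖z‖ - m) ^ 2 ∂stdGaussian (EuclideanSpace ℝ (Fin k)) :=
    integral_nonneg fun z => sq_nonneg _
  have e : ∀ z : EuclideanSpace ℝ (Fin k), (‖z‖ - m) ^ 2 = ‖z‖ ^ 2 - 2 * m * ‖z‖ + m ^ 2 := by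
    intro z; ring
  simp_rw [e] at h
  have hs : Integrable (fun z => ‖z‖ ^ 2 - 2 * m * ‖z‖) (stdGaussian (EuclideanSpace ℝ (Fin k))) :=
    hi.sub (integrable_norm_stdGaussian.const_mul _)
  rw [integral_add hs (integrable_const _),
    integral_sub hi (integrable_norm_stdGaussian.const_mul _), h2, integral_const_mul, ← hm] at h
  apply Real.le_sqrt_of_sq_le
  simp at h
  nlinarith

/-- The Gaussian average `x ↦ 𝔼 F (x + σ Z)`, with `Z` standard Gaussian. -/
noncomputable def gaussianSmooth (σ : ℝ) (F : E → ℝ) (x : E) : ℝ :=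
  ∫ z, F (x + σ • z) ∂stdGaussian E

namespace BddC1

/-- Differentiation of a Gaussian average in the space variable. -/
lemma hasFDerivAt_gaussianSmooth {F : E → ℝ} (hF : BddC1 F) (σ : ℝ) (x : E) :
    HasFDerivAt (gaussianSmooth σ F) (∫ z, fderiv ℝ F (x + σ • z) ∂stdGaussian E) x := by
  obtain ⟨C, hC⟩ := hF.bdd
  obtain ⟨C', hC'⟩ := hF.bdd_fderiv
  refine hasFDerivAt_integral_of_dominated_of_fderiv_le (F := fun x z => F (x + σ • z))
    (F' := fun x z => fderiv ℝ F (x + σ • z)) (bound := fun _ => C') Filter.univ_mem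
    (Eventually.of_forall fun y => ?_) ?_ ?_ (ae_of_all _ fun z y _ => hC' _)
    (integrable_const _) (ae_of_all _ fun z y _ => ?_)
  · exact (hF.continuous.comp (by fun_prop)).aestronglyMeasurable
  · exact Integrable.of_bound (C := C) (hF.continuous.comp (by fun_prop)).aestronglyMeasurable
      (ae_of_all _ fun z => hC _)
  · exact (hF.continuous_fderiv.comp (by fun_prop)).aestronglyMeasurable
  · simpa [Function.comp_def] using (hF.differentiable (y + σ • z)).hasFDerivAt.comp y
      ((hasFDerivAt_id y).add_const (σ • z))

lemma integrable_fderiv {F : E → ℝ} (hF : BddC1 F) (σ : ℝ) (x : E) :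
    Integrable (fun z => fderiv ℝ F (x + σ • z)) (stdGaussian E) := by
  obtain ⟨C', hC'⟩ := hF.bdd_fderiv
  exact Integrable.of_bound (C := C') (hF.continuous_fderiv.comp (by fun_prop)).aestronglyMeasurable
      (ae_of_all _ fun z => hC' _)

lemma dirDeriv_gaussianSmooth {F : E → ℝ} (hF : BddC1 F) (σ : ℝ) (v : E) :
    dirDeriv v (gaussianSmooth σ F) = gaussianSmooth σ (dirDeriv v F) := by
  ext x
  rw [dirDeriv, (hF.hasFDerivAt_gaussianSmooth σ x).fderiv,
    ContinuousLinearMap.integral_apply (hF.integrable_fderiv σ x)]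
  rfl

lemma abs_gaussianSmooth_le {F : E → ℝ} {C : ℝ} (hC : ∀ x, |F x| ≤ C) (σ : ℝ) (x : E) :
    |gaussianSmooth σ F x| ≤ C := by
  have := norm_integral_le_of_norm_le_const (μ := stdGaussian E) (f := fun z => F (x + σ • z))
    (ae_of_all _ fun z => hC _)
  simpa [_root_.gaussianSmooth] using this

lemma gaussianSmooth {F : E → ℝ} (hF : BddC1 F) (σ : ℝ) : BddC1 (gaussianSmooth σ F) := by
  obtain ⟨C, hC⟩ := hF.bdd
  obtain ⟨C', hC'⟩ := hF.bdd_fderiv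
  have hf : fderiv ℝ (_root_.gaussianSmooth σ F) =
      fun x => ∫ z, fderiv ℝ F (x + σ • z) ∂stdGaussian E :=
    funext fun x => (hF.hasFDerivAt_gaussianSmooth σ x).fderiv
  refine ⟨contDiff_one_iff_fderiv.2
    ⟨fun x => (hF.hasFDerivAt_gaussianSmooth σ x).differentiableAt, ?_⟩,
    ⟨C, abs_gaussianSmooth_le hC σ⟩, ⟨C', fun x => ?_⟩⟩
  · rw [hf]
    refine continuous_of_dominated (bound := fun _ => C')
      (fun x => (hF.continuous_fderiv.comp (by fun_prop)).aestronglyMeasurable)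
      (fun x => ae_of_all _ fun z => hC' _) (integrable_const _)
      (ae_of_all _ fun z => hF.continuous_fderiv.comp (by fun_prop))
  · rw [hf]
    have := norm_integral_le_of_norm_le_const (μ := stdGaussian E)
      (f := fun z => fderiv ℝ F (x + σ • z)) (ae_of_all _ fun z => hC' _)
    simpa using this

/-- The Gaussian average of a directional derivative, as a weighted average of the function. -/
lemma integral_mul_inner {F : E → ℝ} (hF : BddC1 F) (σ : ℝ) (x v : E) :
    ∫ z, F (x + σ • z) * ⟪v, z⟫ ∂stdGaussian E =
      σ * _root_.gaussianSmooth σ (dirDeriv v F) x := by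
  obtain ⟨h1, h2⟩ := hF.comp_affine x σ
  rw [integral_mul_inner_stdGaussian h1]
  simp_rw [h2]
  rw [integral_const_mul]
  rfl

/-- Averaging over a Gaussian of standard deviation `σ` turns a bound for a function into a bound
for its gradient, at the price of a factor `𝔼|N(0,1)| / σ`. -/
lemma abs_gaussianSmooth_fderiv_le {F : E → ℝ} (hF : BddC1 F) {σ M : ℝ} (hσ : 0 < σ)
    (hM : ∀ x, |F x| ≤ M) (x v : E) :
    |_root_.gaussianSmooth σ (dirDeriv v F) x| ≤ √(2 / Real.pi) * M * ‖v‖ / σ := by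
  rw [le_div_iff₀ hσ]
  have h := hF.integral_mul_inner σ x v
  calc _ = |∫ z, F (x + σ • z) * ⟪v, z⟫ ∂stdGaussian E| := by
        rw [h, abs_mul, abs_of_pos hσ, mul_comm]
    _ ≤ ∫ z, M * |⟪v, z⟫| ∂stdGaussian E := by
        refine norm_integral_le_of_norm_le (f := fun z => F (x + σ • z) * ⟪v, z⟫)
          ((integrable_inner_stdGaussian v).abs.const_mul M)
          (ae_of_all _ fun z => ?_)
        rw [Real.norm_eq_abs, abs_mul]
        gcongr
        exact hM _
    _ = _ := by rw [integral_const_mul, integral_abs_inner_stdGaussian]; ring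

lemma abs_gaussianSmooth_sub_le {F : E → ℝ} (hF : BddC1 F) {σ M : ℝ} (hσ : 0 < σ)
    (hM : ∀ x, |F x| ≤ M) (x y : E) :
    |_root_.gaussianSmooth σ F x - _root_.gaussianSmooth σ F y| ≤
      √(2 / Real.pi) * M / σ * ‖x - y‖ := by
  refine (hF.gaussianSmooth σ).abs_sub_le (fun z v => ?_) x y
  rw [hF.dirDeriv_gaussianSmooth]
  refine (hF.abs_gaussianSmooth_fderiv_le hσ hM z v).trans_eq ?_
  ring

end BddC1

/-- The sum of independent centred Gaussians of standard deviations `a` and `b` is a Gaussian of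
standard deviation `√(a ^ 2 + b ^ 2)`. -/
lemma map_add_stdGaussian_prod (a b : ℝ) :
    ((stdGaussian E).prod (stdGaussian E)).map (fun p => a • p.1 + b • p.2) =
      (stdGaussian E).map (fun z => √(a ^ 2 + b ^ 2) • z) := by
  have hm : Measurable (fun p : E × E => a • p.1 + b • p.2) := by fun_prop
  have : IsProbabilityMeasure (((stdGaussian E).prod (stdGaussian E)).map
    (fun p => a • p.1 + b • p.2)) := Measure.isProbabilityMeasure_map hm.aemeasurable
  have : IsProbabilityMeasure ((stdGaussian E).map (fun z => √(a ^ 2 + b ^ 2) • z)) :=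
    Measure.isProbabilityMeasure_map (by fun_prop)
  apply Measure.ext_of_charFun
  ext t
  rw [charFun_map_smul, charFun_stdGaussian, charFun_apply,
    integral_map hm.aemeasurable (by fun_prop)]
  have h : ∀ p : E × E, Complex.exp (⟪a • p.1 + b • p.2, t⟫ * Complex.I) =
      Complex.exp (⟪p.1, a • t⟫ * Complex.I) * Complex.exp (⟪p.2, b • t⟫ * Complex.I) := by
    intro p
    rw [← Complex.exp_add, inner_add_left, real_inner_smul_left, real_inner_smul_left,
      real_inner_smul_right, real_inner_smul_right]
    push_cast
    ring_nf
  simp_rw [h]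
  rw [integral_prod_mul (fun z : E => Complex.exp (⟪z, a • t⟫ * Complex.I))
    (fun z : E => Complex.exp (⟪z, b • t⟫ * Complex.I)), ← charFun_apply, ← charFun_apply,
    charFun_stdGaussian, charFun_stdGaussian, ← Complex.exp_add]
  congr 1
  simp only [norm_smul, Real.norm_eq_abs]
  norm_cast
  rw [mul_pow, mul_pow, mul_pow, sq_abs, sq_abs, sq_abs, Real.sq_sqrt (by positivity)]
  ring

/-- The semigroup property of Gaussian averages. -/
lemma gaussianSmooth_gaussianSmooth {F : E → ℝ} (hF : Continuous F) {C : ℝ} (hC : ∀ x, |F x| ≤ C)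
    (a b : ℝ) (x : E) :
    gaussianSmooth a (gaussianSmooth b F) x = gaussianSmooth √(a ^ 2 + b ^ 2) F x := by
  have hm : Measurable (fun p : E × E => a • p.1 + b • p.2) := by fun_prop
  have h1 : gaussianSmooth √(a ^ 2 + b ^ 2) F x =
      ∫ y, F (x + y) ∂((stdGaussian E).map (fun z => √(a ^ 2 + b ^ 2) • z)) := by
    rw [integral_map (by fun_prop) (by fun_prop), gaussianSmooth]
  rw [h1, ← map_add_stdGaussian_prod, integral_map hm.aemeasurable (by fun_prop), integral_prod]
  · simp only [gaussianSmooth, add_assoc]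
  · exact Integrable.of_bound (C := C)
      (hF.comp (by fun_prop)).aestronglyMeasurable (ae_of_all _ fun z => hC _)

/-- A Gaussian average of the Jacobian of a field of length at most `M` has Hilbert–Schmidt norm
at most `M / σ`, without any loss in the dimension. -/
lemma sum_sq_gaussianSmooth_fderiv_le {k : ℕ} {F : Fin k → EuclideanSpace ℝ (Fin k) → ℝ}
    (hF : ∀ i, BddC1 (F i)) {σ M : ℝ} (hσ : 0 < σ) (hM : ∀ x, ∑ i, F i x ^ 2 ≤ M ^ 2)
    (x : EuclideanSpace ℝ (Fin k)) :
    ∑ i, ∑ j, gaussianSmooth σ (dirDeriv (EuclideanSpace.single j 1) (F i)) x ^ 2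
      ≤ (M / σ) ^ 2 := by
  set e : Fin k → EuclideanSpace ℝ (Fin k) := fun j => EuclideanSpace.single j 1 with he
  set H : Fin k → Fin k → ℝ :=
    fun i j => gaussianSmooth σ (dirDeriv (e j) (F i)) x with hH
  -- Expand `0 ≤ 𝔼 ∑ i, (F i (x + σ Z) - σ (H Z) i) ^ 2`.
  set h : Fin k → EuclideanSpace ℝ (Fin k) := fun i => ∑ j, H i j • e j with hh
  have hhin : ∀ i z, ⟪h i, z⟫ = ∑ j, H i j * ⟪e j, z⟫ := by
    intro i z
    simp [hh, sum_inner, real_inner_smul_left]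
  have hhh : ∀ i, ⟪h i, h i⟫ = ∑ j, H i j ^ 2 := by
    intro i
    rw [hhin]
    refine Finset.sum_congr rfl fun j _ => ?_
    rw [sq]
    congr 1
    rw [he, EuclideanSpace.inner_single_left]
    simp [hh, he, Pi.single_apply]
  have hFint : ∀ i, Integrable (fun z => F i (x + σ • z) ^ 2)
      (stdGaussian (EuclideanSpace ℝ (Fin k))) := by
    intro i
    refine Integrable.of_bound (C := M ^ 2)
      (((hF i).continuous.comp (by fun_prop)).pow 2).aestronglyMeasurable (ae_of_all _ fun z => ?_)
    rw [Real.norm_eq_abs, abs_of_nonneg (sq_nonneg _)]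
    exact (Finset.single_le_sum (f := fun i => F i (x + σ • z) ^ 2)
      (fun i _ => sq_nonneg _) (Finset.mem_univ i)).trans (hM _)
  have hcross : ∀ i, Integrable (fun z => F i (x + σ • z) * ⟪h i, z⟫)
      (stdGaussian (EuclideanSpace ℝ (Fin k))) := by
    intro i
    obtain ⟨C, hC⟩ := (hF i).bdd
    exact (integrable_inner_stdGaussian (h i)).bdd_mul
      ((hF i).continuous.comp (by fun_prop)).aestronglyMeasurable (ae_of_all _ fun z => hC _)
  have hexp : ∀ i, ∫ z, (F i (x + σ • z) - σ * ⟪h i, z⟫) ^ 2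
        ∂stdGaussian (EuclideanSpace ℝ (Fin k)) =
      ∫ z, F i (x + σ • z) ^ 2 ∂stdGaussian (EuclideanSpace ℝ (Fin k)) -
        σ ^ 2 * ∑ j, H i j ^ 2 := by
    intro i
    have e1 : ∀ z, (F i (x + σ • z) - σ * ⟪h i, z⟫) ^ 2 = F i (x + σ • z) ^ 2 -
        2 * σ * (F i (x + σ • z) * ⟪h i, z⟫) + σ ^ 2 * (⟪h i, z⟫ * ⟪h i, z⟫) := by
      intro z; ring
    have e2 : ∫ z, F i (x + σ • z) * ⟪h i, z⟫ ∂stdGaussian (EuclideanSpace ℝ (Fin k)) =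
        σ * ∑ j, H i j ^ 2 := by
      have e3 : gaussianSmooth σ (dirDeriv (h i) (F i)) x = ∑ j, H i j ^ 2 := by
        rw [← (hF i).dirDeriv_gaussianSmooth, dirDeriv, hh, map_sum]
        refine Finset.sum_congr rfl fun j _ => ?_
        rw [map_smul, ← dirDeriv, (hF i).dirDeriv_gaussianSmooth, smul_eq_mul, sq]
      rw [(hF i).integral_mul_inner, e3]
    simp_rw [e1]
    have hs : Integrable (fun z => F i (x + σ • z) ^ 2 - 2 * σ * (F i (x + σ • z) * ⟪h i, z⟫))
        (stdGaussian (EuclideanSpace ℝ (Fin k))) := (hFint i).sub ((hcross i).const_mul _)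
    rw [integral_add hs
      ((integrable_inner_mul_inner_stdGaussian _ _).const_mul _),
      integral_sub (hFint i) ((hcross i).const_mul _), integral_const_mul, integral_const_mul, e2,
      integral_inner_mul_inner_stdGaussian, hhh]
    ring
  have h1 : 0 ≤ ∑ i, ∫ z, (F i (x + σ • z) - σ * ⟪h i, z⟫) ^ 2
      ∂stdGaussian (EuclideanSpace ℝ (Fin k)) :=
    Finset.sum_nonneg fun i _ => integral_nonneg fun z => sq_nonneg _
  simp_rw [hexp] at h1
  rw [Finset.sum_sub_distrib, ← integral_finsetSum _ fun i _ => hFint i, ← Finset.mul_sum] at h1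
  have h2 : ∫ z, ∑ i, F i (x + σ • z) ^ 2 ∂stdGaussian (EuclideanSpace ℝ (Fin k)) ≤ M ^ 2 := by
    refine (integral_mono (integrable_finsetSum _ fun i _ => hFint i)
      (integrable_const (M ^ 2)) fun z => hM _).trans ?_
    simp
  rw [div_pow, le_div_iff₀ (by positivity)]
  linarith

end GaussianSmoothing

/-! ### Stein pairs and the second-order exchange inequality -/

section SteinPair

/-- Two identically distributed random vectors `W`, `W'` form an approximate Stein pair with rate
`lam` and error `E` if `W' - W` is square integrable and, given `W`, has conditional mean
`-lam * W` and conditional second moments `2 * lam * δ + E`. -/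
structure IsSteinPair {k : ℕ} {Ω : Type*} [MeasurableSpace Ω] (P : Measure Ω)
    (W W' : Ω → EuclideanSpace ℝ (Fin k)) (lam : ℝ) (E : Fin k → Fin k → Ω → ℝ) : Prop where
  measurable : Measurable W
  measurable' : Measurable W'
  identDistrib : IdentDistrib W W' P P
  memLp : MemLp (fun ω => W' ω - W ω) 2 P
  lam_pos : 0 < lam
  condExp_diff : ∀ i, P[fun ω => W' ω i - W ω i | MeasurableSpace.comap W inferInstance]
    =ᵐ[P] fun ω => -lam * W ω i
  condExp_mul : ∀ i j, P[fun ω => (W' ω i - W ω i) * (W' ω j - W ω j) |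
      MeasurableSpace.comap W inferInstance]
    =ᵐ[P] fun ω => 2 * lam * (if i = j then 1 else 0) + E i j ω

/-- Pulling a bounded function of `W` out of a conditional expectation given `W`. -/
lemma integral_comp_mul_eq_of_condExp {X Ω : Type*} [MeasurableSpace X] [MeasurableSpace Ω]
    {P : Measure Ω} [IsProbabilityMeasure P] {W : Ω → X} (hW : Measurable W) {g c : Ω → ℝ}
    (hg : Integrable g P) (hc : P[g | MeasurableSpace.comap W inferInstance] =ᵐ[P] c)
    {u : X → ℝ} (hu : Measurable u) {C : ℝ} (hC : ∀ x, |u x| ≤ C) :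
    ∫ ω, u (W ω) * g ω ∂P = ∫ ω, u (W ω) * c ω ∂P := by
  have hm : MeasurableSpace.comap W inferInstance ≤ ‹MeasurableSpace Ω› := hW.comap_le
  have hsm : StronglyMeasurable[MeasurableSpace.comap W inferInstance] (fun ω => u (W ω)) :=
    (hu.comp (comap_measurable W)).stronglyMeasurable
  have hint : Integrable ((fun ω => u (W ω)) * g) P :=
    hg.bdd_mul (hu.comp hW).aestronglyMeasurable (ae_of_all _ fun ω => hC _)
  have h := condExp_mul_of_stronglyMeasurable_left hsm hint hg
  have h1 := integral_condExp hm (f := (fun ω => u (W ω)) * g) (μ := P)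
  rw [integral_congr_ae h] at h1
  refine (h1.symm.trans (integral_congr_ae ?_) :)
  filter_upwards [hc] with ω hω
  simp [hω]

namespace IsSteinPair

variable {k : ℕ} {Ω : Type*} [MeasurableSpace Ω] {P : Measure Ω}
    {W W' : Ω → EuclideanSpace ℝ (Fin k)} {lam : ℝ} {E : Fin k → Fin k → Ω → ℝ}

lemma memLp_diff (h : IsSteinPair P W W' lam E) (i : Fin k) :
    MemLp (fun ω => W' ω i - W ω i) 2 P := by
  refine h.memLp.mono ?_ (ae_of_all _ fun ω => ?_)
  · have h1 := h.measurable
    have h2 := h.measurable'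
    exact Measurable.aestronglyMeasurable (by fun_prop)
  · exact PiLp.norm_apply_le (W' ω - W ω) i

lemma integrable_diff_mul (h : IsSteinPair P W W' lam E) (i j : Fin k) :
    Integrable (fun ω => (W' ω i - W ω i) * (W' ω j - W ω j)) P :=
  (h.memLp_diff i).integrable_mul (h.memLp_diff j)

lemma integrable_coord (h : IsSteinPair P W W' lam E) (i : Fin k) :
    Integrable (fun ω => W ω i) P := by
  have h1 : Integrable (fun ω => -lam * W ω i) P :=
    (integrable_condExp (m := MeasurableSpace.comap W inferInstance)).congr (h.condExp_diff i)
  have h2 := h1.const_mul (-lam⁻¹)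
  refine h2.congr (ae_of_all _ fun ω => ?_)
  have := h.lam_pos.ne'
  simp only
  field_simp

lemma integrable (h : IsSteinPair P W W' lam E) : Integrable W P := by
  have h1 : Integrable (fun ω => ∑ i, W ω i • EuclideanSpace.single i (1 : ℝ)) P :=
    integrable_finsetSum _ fun i _ => (h.integrable_coord i).smul_const _
  refine h1.congr (ae_of_all _ fun ω => ?_)
  simpa using (EuclideanSpace.basisFun (Fin k) ℝ).sum_repr (W ω)

variable [IsProbabilityMeasure P]

lemma integrable_diff (h : IsSteinPair P W W' lam E) (i : Fin k) :
    Integrable (fun ω => W' ω i - W ω i) P :=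
  (h.memLp_diff i).integrable (by norm_num)

lemma integrable_error (h : IsSteinPair P W W' lam E) (i j : Fin k) :
    Integrable (E i j) P := by
  have h1 : Integrable (fun ω => 2 * lam * (if i = j then 1 else 0) + E i j ω) P :=
    (integrable_condExp (m := MeasurableSpace.comap W inferInstance)).congr (h.condExp_mul i j)
  refine (h1.sub (integrable_const (2 * lam * (if i = j then 1 else 0)))).congr
    (ae_of_all _ fun ω => ?_)
  simp

lemma integrable_sqrt_error (h : IsSteinPair P W W' lam E) :
    Integrable (fun ω => √(∑ i, ∑ j, E i j ω ^ 2)) P := by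
  have h1 : Integrable (fun ω => ∑ i, ∑ j, |E i j ω|) P :=
    integrable_finsetSum _ fun i _ => integrable_finsetSum _ fun j _ => (h.integrable_error i j).abs
  refine h1.mono ?_ (ae_of_all _ fun ω => ?_)
  · have : AEMeasurable (fun ω => ∑ i, ∑ j, E i j ω ^ 2) P :=
      Finset.aemeasurable_fun_sum _ fun i _ => Finset.aemeasurable_fun_sum _ fun j _ =>
        (h.integrable_error i j).aemeasurable.pow_const 2
    exact this.sqrt.aestronglyMeasurable
  · have h0 : ∀ i, 0 ≤ ∑ j, |E i j ω| := fun i => Finset.sum_nonneg fun j _ => abs_nonneg _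
    rw [Real.norm_of_nonneg (Real.sqrt_nonneg _),
      Real.norm_of_nonneg (Finset.sum_nonneg fun i _ => h0 i)]
    refine Real.sqrt_le_iff.2 ⟨Finset.sum_nonneg fun i _ => h0 i, ?_⟩
    calc ∑ i, ∑ j, E i j ω ^ 2 = ∑ i, ∑ j, |E i j ω| ^ 2 := by simp_rw [sq_abs]
      _ ≤ ∑ i, (∑ j, |E i j ω|) ^ 2 :=
        Finset.sum_le_sum fun i _ => Finset.sum_sq_le_sq_sum_of_nonneg fun j _ => abs_nonneg _
      _ ≤ _ := Finset.sum_sq_le_sq_sum_of_nonneg fun i _ => h0 i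

/-- A test function `u` with gradient `G` and Hessian `H` satisfies `𝔼 u(W') = 𝔼 u(W)`. Expanding
the difference to second order and taking conditional expectations given `W` bounds
`𝔼 (Δu(W) - W · ∇u(W))`. -/
lemma abs_integral_stein_le (h : IsSteinPair P W W' lam E)
    (hT : Integrable (fun ω => ‖W' ω - W ω‖ ^ 3) P) {u : EuclideanSpace ℝ (Fin k) → ℝ}
    {G : Fin k → EuclideanSpace ℝ (Fin k) → ℝ} {H : Fin k → Fin k → EuclideanSpace ℝ (Fin k) → ℝ}
    (hu : Measurable u) (hub : ∃ C, ∀ x, |u x| ≤ C)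
    (hG : ∀ i, Measurable (G i)) (hGb : ∀ i, ∃ C, ∀ x, |G i x| ≤ C)
    (hH : ∀ i j, Measurable (H i j)) (hHb : ∀ i j, ∃ C, ∀ x, |H i j x| ≤ C)
    {m₂ m₃ : ℝ} (hm₂ : 0 ≤ m₂) (hHS : ∀ x, ∑ i, ∑ j, H i j x ^ 2 ≤ m₂ ^ 2)
    (htaylor : ∀ x d, |u (x + d) - u x - ∑ i, G i x * d i - 1 / 2 * ∑ i, ∑ j, H i j x * (d i * d j)|
      ≤ m₃ / 6 * ‖d‖ ^ 3) :
    |∫ ω, (∑ i, H i i (W ω) - ∑ i, G i (W ω) * W ω i) ∂P| ≤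
      (m₂ / 2 * ∫ ω, √(∑ i, ∑ j, E i j ω ^ 2) ∂P + m₃ / 6 * ∫ ω, ‖W' ω - W ω‖ ^ 3 ∂P) / lam := by
  have hW := h.measurable
  have hW' := h.measurable'
  have iGD : ∀ i, Integrable (fun ω => G i (W ω) * (W' ω i - W ω i)) P := fun i => by
    obtain ⟨C, hC⟩ := hGb i
    exact (h.integrable_diff i).bdd_mul ((hG i).comp hW).aestronglyMeasurable
      (ae_of_all _ fun ω => hC _)
  have iGW : ∀ i, Integrable (fun ω => G i (W ω) * W ω i) P := fun i => by
    obtain ⟨C, hC⟩ := hGb i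
    exact (h.integrable_coord i).bdd_mul ((hG i).comp hW).aestronglyMeasurable
      (ae_of_all _ fun ω => hC _)
  have iH : ∀ i j, Integrable (fun ω => H i j (W ω)) P := fun i j => by
    obtain ⟨C, hC⟩ := hHb i j
    exact Integrable.of_bound ((hH i j).comp hW).aestronglyMeasurable C (ae_of_all _ fun ω => hC _)
  have iHE : ∀ i j, Integrable (fun ω => H i j (W ω) * E i j ω) P := fun i j => by
    obtain ⟨C, hC⟩ := hHb i j
    exact (h.integrable_error i j).bdd_mul ((hH i j).comp hW).aestronglyMeasurable
      (ae_of_all _ fun ω => hC _)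
  have iHD : ∀ i j, Integrable (fun ω => H i j (W ω) * ((W' ω i - W ω i) * (W' ω j - W ω j))) P :=
    fun i j => by
      obtain ⟨C, hC⟩ := hHb i j
      exact (h.integrable_diff_mul i j).bdd_mul ((hH i j).comp hW).aestronglyMeasurable
        (ae_of_all _ fun ω => hC _)
  have eG : ∀ i, ∫ ω, G i (W ω) * (W' ω i - W ω i) ∂P = -lam * ∫ ω, G i (W ω) * W ω i ∂P := by
    intro i
    obtain ⟨C, hC⟩ := hGb i
    rw [integral_comp_mul_eq_of_condExp hW (h.integrable_diff i) (h.condExp_diff i) (hG i) hC,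
      ← integral_const_mul]
    congr 1 with ω
    ring
  have eH : ∀ i j, ∫ ω, H i j (W ω) * ((W' ω i - W ω i) * (W' ω j - W ω j)) ∂P =
      2 * lam * (if i = j then ∫ ω, H i j (W ω) ∂P else 0) + ∫ ω, H i j (W ω) * E i j ω ∂P := by
    intro i j
    obtain ⟨C, hC⟩ := hHb i j
    rw [integral_comp_mul_eq_of_condExp hW (h.integrable_diff_mul i j) (h.condExp_mul i j)
      (hH i j) hC]
    have e : ∀ ω, H i j (W ω) * (2 * lam * (if i = j then 1 else 0) + E i j ω) =
        2 * lam * (if i = j then 1 else 0) * H i j (W ω) + H i j (W ω) * E i j ω := by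
      intro ω; ring
    simp_rw [e]
    rw [integral_add ((iH i j).const_mul _) (iHE i j), integral_const_mul]
    split_ifs <;> ring
  obtain ⟨Cu, hCu⟩ := hub
  have iu : Integrable (fun ω => u (W ω)) P :=
    Integrable.of_bound (hu.comp hW).aestronglyMeasurable Cu (ae_of_all _ fun ω => hCu _)
  have iu' : Integrable (fun ω => u (W' ω)) P :=
    Integrable.of_bound (hu.comp hW').aestronglyMeasurable Cu (ae_of_all _ fun ω => hCu _)
  have eu : ∫ ω, u (W' ω) ∂P = ∫ ω, u (W ω) ∂P := ((h.identDistrib.comp hu).integral_eq).symm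
  have isG : Integrable (fun ω => ∑ i, G i (W ω) * (W' ω i - W ω i)) P :=
    integrable_finsetSum _ fun i _ => iGD i
  have isH : Integrable
      (fun ω => ∑ i, ∑ j, H i j (W ω) * ((W' ω i - W ω i) * (W' ω j - W ω j))) P :=
    integrable_finsetSum _ fun i _ => integrable_finsetSum _ fun j _ => iHD i j
  have isE : Integrable (fun ω => ∑ i, ∑ j, H i j (W ω) * E i j ω) P :=
    integrable_finsetSum _ fun i _ => integrable_finsetSum _ fun j _ => iHE i j
  set R : Ω → ℝ := fun ω => u (W' ω) - u (W ω) - ∑ i, G i (W ω) * (W' ω i - W ω i) -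
    1 / 2 * ∑ i, ∑ j, H i j (W ω) * ((W' ω i - W ω i) * (W' ω j - W ω j)) with hR
  have iuu : Integrable (fun ω => u (W' ω) - u (W ω)) P := iu'.sub iu
  have iuuG : Integrable (fun ω => u (W' ω) - u (W ω) - ∑ i, G i (W ω) * (W' ω i - W ω i)) P :=
    iuu.sub isG
  have hRle : |∫ ω, R ω ∂P| ≤ m₃ / 6 * ∫ ω, ‖W' ω - W ω‖ ^ 3 ∂P := by
    rw [← integral_const_mul]
    refine norm_integral_le_of_norm_le (f := R) (hT.const_mul _) (ae_of_all _ fun ω => ?_)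
    have := htaylor (W ω) (W' ω - W ω)
    simpa [hR] using this
  have hEle : |∫ ω, ∑ i, ∑ j, H i j (W ω) * E i j ω ∂P| ≤
      m₂ * ∫ ω, √(∑ i, ∑ j, E i j ω ^ 2) ∂P := by
    rw [← integral_const_mul]
    refine norm_integral_le_of_norm_le (f := fun ω => ∑ i, ∑ j, H i j (W ω) * E i j ω)
      (h.integrable_sqrt_error.const_mul _) (ae_of_all _ fun ω => ?_)
    rw [Real.norm_eq_abs, ← Real.sqrt_sq hm₂, ← Real.sqrt_mul (sq_nonneg _)]
    apply Real.abs_le_sqrt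
    have hcs := Finset.sum_mul_sq_le_sq_mul_sq (Finset.univ : Finset (Fin k × Fin k))
      (fun p => H p.1 p.2 (W ω)) (fun p => E p.1 p.2 ω)
    simp_rw [← Finset.univ_product_univ, Finset.sum_product] at hcs
    refine hcs.trans ?_
    gcongr
    · exact hHS _
  have key : ∫ ω, R ω ∂P = lam * ∑ i, ∫ ω, G i (W ω) * W ω i ∂P -
      (lam * ∑ i, ∫ ω, H i i (W ω) ∂P + 1 / 2 * ∫ ω, ∑ i, ∑ j, H i j (W ω) * E i j ω ∂P) := by
    simp only [hR]
    rw [integral_sub iuuG (isH.const_mul _), integral_sub iuu isG, integral_sub iu' iu, eu,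
      integral_const_mul, integral_finsetSum _ fun i _ => iGD i,
      integral_finsetSum _ fun i _ => integrable_finsetSum _ fun j _ => iHD i j,
      integral_finsetSum _ fun i _ => integrable_finsetSum _ fun j _ => iHE i j]
    simp_rw [eG, integral_finsetSum _ fun j _ => iHD _ j, integral_finsetSum _ fun j _ => iHE _ j,
      eH, Finset.sum_add_distrib, ← Finset.mul_sum]
    simp only [Finset.sum_ite_eq, Finset.mem_univ, if_true]
    ring
  have goal : ∫ ω, (∑ i, H i i (W ω) - ∑ i, G i (W ω) * W ω i) ∂P =
      (-(1 / 2 * ∫ ω, ∑ i, ∑ j, H i j (W ω) * E i j ω ∂P) - ∫ ω, R ω ∂P) / lam := by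
    rw [integral_sub (integrable_finsetSum _ fun i _ => iH i i)
      (integrable_finsetSum _ fun i _ => iGW i), integral_finsetSum _ fun i _ => iH i i,
      integral_finsetSum _ fun i _ => iGW i, eq_div_iff h.lam_pos.ne', key]
    ring
  rw [goal, abs_div, abs_of_pos h.lam_pos]
  gcongr
  · exact h.lam_pos.le
  rw [abs_le] at *
  constructor <;> linarith [hRle.1, hRle.2, hEle.1, hEle.2]

end IsSteinPair

end SteinPair

/-! ### Interpolation between the two laws -/

section Interpolation

/-- A function that is bounded together with its derivatives up to order three. -/
structure BddC3 {E : Type*} [NormedAddCommGroup E] [InnerProductSpace ℝ E] (f : E → ℝ) : Prop where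
  bddC1 : BddC1 f
  bddC1_dirDeriv : ∀ v, BddC1 (dirDeriv v f)
  bddC1_dirDeriv_dirDeriv : ∀ v w, BddC1 (dirDeriv w (dirDeriv v f))

lemma dirDeriv_eq_sum {k : ℕ} (f : EuclideanSpace ℝ (Fin k) → ℝ) (x v : EuclideanSpace ℝ (Fin k)) :
    dirDeriv v f x = ∑ i, v i * dirDeriv (EuclideanSpace.single i 1) f x := by
  have h : v = ∑ i, v i • EuclideanSpace.single i (1 : ℝ) := by
    simpa using ((EuclideanSpace.basisFun (Fin k) ℝ).sum_repr v).symm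
  conv_lhs => rw [dirDeriv, h, map_sum]
  simp [dirDeriv]

namespace BddC3

lemma gaussianSmooth {E : Type*} [NormedAddCommGroup E] [InnerProductSpace ℝ E]
    [FiniteDimensional ℝ E] [MeasurableSpace E] [BorelSpace E] {f : E → ℝ} (hf : BddC3 f) (σ : ℝ) :
    BddC3 (gaussianSmooth σ f) where
  bddC1 := hf.bddC1.gaussianSmooth σ
  bddC1_dirDeriv v := by
    rw [hf.bddC1.dirDeriv_gaussianSmooth]
    exact (hf.bddC1_dirDeriv v).gaussianSmooth σ
  bddC1_dirDeriv_dirDeriv v w := by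
    rw [hf.bddC1.dirDeriv_gaussianSmooth, (hf.bddC1_dirDeriv v).dirDeriv_gaussianSmooth]
    exact (hf.bddC1_dirDeriv_dirDeriv v w).gaussianSmooth σ

lemma dirDeriv_dirDeriv_eq_sum {k : ℕ} {f : EuclideanSpace ℝ (Fin k) → ℝ} (hf : BddC3 f)
    (x v : EuclideanSpace ℝ (Fin k)) :
    dirDeriv v (dirDeriv v f) x = ∑ i, ∑ j,
      dirDeriv (EuclideanSpace.single j 1) (dirDeriv (EuclideanSpace.single i 1) f) x *
        (v i * v j) := by
  have h : dirDeriv v f = fun y => ∑ i, v i * dirDeriv (EuclideanSpace.single i 1) f y :=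
    funext fun y => dirDeriv_eq_sum f y v
  have hd : ∀ i : Fin k, DifferentiableAt ℝ (dirDeriv (EuclideanSpace.single i (1 : ℝ)) f) x :=
    fun i => (hf.bddC1_dirDeriv _).differentiable x
  rw [h, dirDeriv, fderiv_fun_sum fun i _ => (hd i).const_mul _, sum_apply]
  refine Finset.sum_congr rfl fun i _ => ?_
  rw [fderiv_const_mul (hd i), smul_apply, ← dirDeriv, dirDeriv_eq_sum,
    smul_eq_mul, Finset.mul_sum]
  refine Finset.sum_congr rfl fun j _ => ?_
  ring

lemma _root_.BddC1.hasDerivAt_line {E : Type*} [NormedAddCommGroup E] [InnerProductSpace ℝ E]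
    {f : E → ℝ} (hf : BddC1 f) (x d : E) (s : ℝ) :
    HasDerivAt (fun s : ℝ => f (x + s • d)) (dirDeriv d f (x + s • d)) s := by
  have h1 : HasDerivAt (fun s : ℝ => x + s • d) d s := by
    simpa using ((hasDerivAt_id s).smul_const d).const_add x
  exact (hf.differentiable (x + s • d)).hasFDerivAt.comp_hasDerivAt s h1

/-- Taylor's formula of order two, with the remainder controlled by the modulus of continuity of the
second derivative in the direction of the increment. -/
lemma abs_taylor_le {k : ℕ} {f : EuclideanSpace ℝ (Fin k) → ℝ} (hf : BddC3 f)
    (x d : EuclideanSpace ℝ (Fin k)) {m : ℝ}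
    (hm : ∀ s : ℝ, 0 ≤ s → |dirDeriv d (dirDeriv d f) (x + s • d) - dirDeriv d (dirDeriv d f) x|
      ≤ m * s) :
    |f (x + d) - f x - ∑ i, dirDeriv (EuclideanSpace.single i 1) f x * d i -
      1 / 2 * ∑ i, ∑ j, dirDeriv (EuclideanSpace.single j 1)
        (dirDeriv (EuclideanSpace.single i 1) f) x * (d i * d j)| ≤ m / 6 := by
  rw [← hf.dirDeriv_dirDeriv_eq_sum]
  simp_rw [mul_comm _ (d _)]
  rw [← dirDeriv_eq_sum]
  set a := dirDeriv d f x with ha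
  set b := dirDeriv d (dirDeriv d f) x with hb
  have h1 : ∀ s ∈ Set.Icc (0 : ℝ) 1, ‖dirDeriv d f (x + s • d) - a - s * b‖ ≤ m / 2 * s ^ 2 := by
    refine fun s hs => image_norm_le_of_norm_deriv_right_le_deriv_boundary
      (f := fun s => dirDeriv d f (x + s • d) - a - s * b)
      (f' := fun s => dirDeriv d (dirDeriv d f) (x + s • d) - b) (B := fun s => m / 2 * s ^ 2)
      (B' := fun s => m * s)
      (fun s _ => ?_) (fun s _ => ?_) ?_ (fun s => ?_) (fun s hs => ?_) hs
    rotate_left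
    · have := (((hf.bddC1_dirDeriv d).hasDerivAt_line x d s).sub_const a).fun_sub
        ((hasDerivAt_id' s).mul_const b)
      exact (this.congr_deriv (by simp)).hasDerivWithinAt
    · simp [ha]
    · refine ((hasDerivAt_pow 2 s).const_mul (m / 2)).congr_deriv ?_
      simp
      ring
    · exact hm s hs.1
    · have := (((hf.bddC1_dirDeriv d).hasDerivAt_line x d s).sub_const a).sub
        ((hasDerivAt_id s).mul_const b)
      exact this.continuousAt.continuousWithinAt
  have h2 : ∀ s ∈ Set.Icc (0 : ℝ) 1,
      ‖f (x + s • d) - f x - s * a - s ^ 2 / 2 * b‖ ≤ m / 6 * s ^ 3 := by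
    have hD : ∀ s : ℝ, HasDerivAt (fun s : ℝ => f (x + s • d) - f x - s * a - s ^ 2 / 2 * b)
        (dirDeriv d f (x + s • d) - a - s * b) s := by
      intro s
      have := (((hf.bddC1.hasDerivAt_line x d s).sub_const (f x)).sub
        ((hasDerivAt_id s).mul_const a)).sub (((hasDerivAt_pow 2 s).div_const 2).mul_const b)
      refine this.congr_deriv ?_
      simp
    refine fun s hs => image_norm_le_of_norm_deriv_right_le_deriv_boundary
      (f' := fun s => dirDeriv d f (x + s • d) - a - s * b) (B := fun s => m / 6 * s ^ 3)
      (B' := fun s => m / 2 * s ^ 2)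
      (fun s _ => (hD s).continuousAt.continuousWithinAt) (fun s _ => (hD s).hasDerivWithinAt)
      ?_ (fun s => ?_) (fun s hs => h1 s ⟨hs.1, hs.2.le⟩) hs
    · simp
    · refine ((hasDerivAt_pow 3 s).const_mul (m / 6)).congr_deriv ?_
      simp
      ring
  have := h2 1 (by simp)
  rw [Real.norm_eq_abs] at this
  simpa using this

end BddC3

/-- The standard deviation of the Gaussian part at time `r` of the interpolation. -/
noncomputable def interpStd (t r : ℝ) : ℝ := √(1 - r ^ 2 + t ^ 2)

lemma le_interpStd {t r : ℝ} (hr : r ∈ Set.Icc (0 : ℝ) 1) : t ≤ interpStd t r := by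
  apply Real.le_sqrt_of_sq_le
  nlinarith [hr.1, hr.2]

lemma hasDerivAt_interpStd {t r : ℝ} (ht : 0 < t) (hr : r ∈ Set.Icc (0 : ℝ) 1) :
    HasDerivAt (interpStd t) (-r / interpStd t r) r := by
  have h0 : 1 - r ^ 2 + t ^ 2 ≠ 0 := by nlinarith [hr.1, hr.2, sq_pos_of_pos ht]
  have h1 : HasDerivAt (fun r : ℝ => 1 - r ^ 2 + t ^ 2) (-(2 * r)) r := by
    simpa using ((hasDerivAt_pow 2 r).const_sub 1).add_const (t ^ 2)
  refine (h1.sqrt h0).congr_deriv ?_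
  rw [interpStd]
  ring

variable {k : ℕ} {Ω : Type*} [MeasurableSpace Ω] {P : Measure Ω} [IsProbabilityMeasure P]
    {W W' : Ω → EuclideanSpace ℝ (Fin k)} {lam : ℝ} {E : Fin k → Fin k → Ω → ℝ}

/-- The interpolation `r ↦ 𝔼 f (r W + √(1 - r² + t²) Z)` between `𝔼 f (√(1 + t²) Z)` at `r = 0` and
`𝔼 f (W + t Z)` at `r = 1`, where the Gaussian vector `Z` is independent of `W`. -/
noncomputable def interp (P : Measure Ω) (W : Ω → EuclideanSpace ℝ (Fin k))
    (f : EuclideanSpace ℝ (Fin k) → ℝ) (t r : ℝ) : ℝ :=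
  ∫ ω, gaussianSmooth (interpStd t r) f (r • W ω) ∂P

lemma interp_eq_integral_prod (hW : Measurable W) {f : EuclideanSpace ℝ (Fin k) → ℝ}
    (hf : BddC1 f) (t r : ℝ) :
    interp P W f t r = ∫ p, f (r • W p.1 + interpStd t r • p.2)
      ∂(P.prod (stdGaussian (EuclideanSpace ℝ (Fin k)))) := by
  obtain ⟨C, hC⟩ := hf.bdd
  rw [integral_prod]
  · rfl
  · exact Integrable.of_bound
      (hf.continuous.measurable.comp (by fun_prop)).aestronglyMeasurable C
      (ae_of_all _ fun p => hC _)

lemma continuousOn_interp (hW : Measurable W) {f : EuclideanSpace ℝ (Fin k) → ℝ}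
    (hf : BddC1 f) {t : ℝ} (ht : 0 < t) : ContinuousOn (interp P W f t) (Set.Icc 0 1) := by
  obtain ⟨C, hC⟩ := hf.bdd
  have : ContinuousOn (fun r => ∫ p, f (r • W p.1 + interpStd t r • p.2)
      ∂(P.prod (stdGaussian (EuclideanSpace ℝ (Fin k))))) (Set.Icc 0 1) := by
    refine continuousOn_of_dominated (bound := fun _ => C) (fun r _ =>
      (hf.continuous.measurable.comp (by fun_prop)).aestronglyMeasurable)
      (fun r _ => ae_of_all _ fun p => hC _) (integrable_const _) (ae_of_all _ fun p => ?_)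
    have h1 : ContinuousOn (interpStd t) (Set.Icc 0 1) := fun r hr =>
      (hasDerivAt_interpStd ht hr).continuousAt.continuousWithinAt
    exact hf.continuous.comp_continuousOn
      ((continuousOn_id.smul continuousOn_const).add (h1.smul continuousOn_const))
  exact this.congr fun r _ => interp_eq_integral_prod hW hf t r

/-- The derivative of the interpolation, after a Gaussian integration by parts. -/
lemma hasDerivAt_interp (hW : Measurable W) (hWi : Integrable W P)
    {f : EuclideanSpace ℝ (Fin k) → ℝ} (hf : BddC3 f) {t r : ℝ} (ht : 0 < t)
    (hr : r ∈ Set.Ioo (0 : ℝ) 1) :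
    HasDerivAt (interp P W f t) (∫ ω, (∑ i, gaussianSmooth (interpStd t r)
        (dirDeriv (EuclideanSpace.single i 1) f) (r • W ω) * W ω i
      - r * ∑ i, gaussianSmooth (interpStd t r) (dirDeriv (EuclideanSpace.single i 1)
        (dirDeriv (EuclideanSpace.single i 1) f)) (r • W ω)) ∂P) r := by
  obtain ⟨C, hC⟩ := hf.bddC1.bdd
  obtain ⟨C', hC'⟩ := hf.bddC1.bdd_fderiv
  have hC'0 : 0 ≤ C' := (norm_nonneg _).trans (hC' 0)
  set γ := stdGaussian (EuclideanSpace ℝ (Fin k)) with hγ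
  set σ := interpStd t r with hσ
  have hσ0 : 0 < σ := ht.trans_le (le_interpStd ⟨hr.1.le, hr.2.le⟩)
  have hfun : interp P W f t = fun r => ∫ p, f (r • W p.1 + interpStd t r • p.2) ∂(P.prod γ) :=
    funext fun r => interp_eq_integral_prod hW hf.bddC1 t r
  have hbint : Integrable (fun p : Ω × EuclideanSpace ℝ (Fin k) =>
      C' * (‖W p.1‖ + 1 / t * ‖p.2‖)) (P.prod γ) :=
    ((hWi.norm.comp_fst γ).add ((integrable_norm_stdGaussian.comp_snd P).const_mul _)).const_mul _
  have hmeas : ∀ r : ℝ, Measurable (fun p : Ω × EuclideanSpace ℝ (Fin k) =>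
      r • W p.1 + interpStd t r • p.2) := fun r => by fun_prop
  set F' : ℝ → Ω × EuclideanSpace ℝ (Fin k) → ℝ := fun r p =>
    fderiv ℝ f (r • W p.1 + interpStd t r • p.2) (W p.1 + (-r / interpStd t r) • p.2) with hF'
  have hm' : Measurable (F' r) := by
    have h1 := hf.bddC1.continuous_fderiv.measurable.comp (hmeas r)
    have h2 : Measurable (fun p : Ω × EuclideanSpace ℝ (Fin k) =>
      W p.1 + (-r / interpStd t r) • p.2) := by fun_prop
    exact (isBoundedBilinearMap_apply (𝕜 := ℝ) (E := EuclideanSpace ℝ (Fin k)) (F := ℝ)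
      ).continuous.measurable.comp (h1.prodMk h2)
  have hb' : ∀ p, ∀ r' ∈ Set.Ioo (0 : ℝ) 1, ‖F' r' p‖ ≤ C' * (‖W p.1‖ + 1 / t * ‖p.2‖) := by
    intro p r' hr'
    have h1 := le_interpStd (t := t) (⟨hr'.1.le, hr'.2.le⟩ : r' ∈ Set.Icc (0 : ℝ) 1)
    refine (ContinuousLinearMap.le_opNorm _ _).trans ?_
    gcongr
    · exact hC' _
    · refine (norm_add_le _ _).trans ?_
      rw [norm_smul, Real.norm_eq_abs, abs_div, abs_neg, abs_of_pos hr'.1,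
        abs_of_pos (ht.trans_le h1)]
      gcongr
      exact hr'.2.le
  have hd' : ∀ p, ∀ r' ∈ Set.Ioo (0 : ℝ) 1,
      HasDerivAt (fun r => f (r • W p.1 + interpStd t r • p.2)) (F' r' p) r' := by
    intro p r' hr'
    have h1 : HasDerivAt (fun r => r • W p.1 + interpStd t r • p.2)
        (W p.1 + (-r' / interpStd t r') • p.2) r' := by
      have := ((hasDerivAt_id r').smul_const (W p.1)).fun_add
        ((hasDerivAt_interpStd ht ⟨hr'.1.le, hr'.2.le⟩).smul_const p.2)
      simpa using this
    exact (hf.bddC1.differentiable _).hasFDerivAt.comp_hasDerivAt r' h1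
  obtain ⟨hint, hder⟩ := hasDerivAt_integral_of_dominated_loc_of_deriv_le
    (μ := P.prod γ) (F := fun r p => f (r • W p.1 + interpStd t r • p.2))
    (F' := F') (s := Set.Ioo 0 1) (x₀ := r)
    (bound := fun p => C' * (‖W p.1‖ + 1 / t * ‖p.2‖)) (isOpen_Ioo.mem_nhds hr)
    (Eventually.of_forall fun r =>
      (hf.bddC1.continuous.measurable.comp (hmeas r)).aestronglyMeasurable)
    (Integrable.of_bound (hf.bddC1.continuous.measurable.comp (hmeas r)).aestronglyMeasurable C
      (ae_of_all _ fun p => hC _))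
    hm'.aestronglyMeasurable
    (ae_of_all _ hb') hbint (ae_of_all _ hd')
  rw [hfun]
  refine hder.congr_deriv ?_
  rw [integral_prod _ hint]
  congr 1 with ω
  set x := r • W ω with hx
  have i1 := hf.bddC1.integrable_fderiv σ x
  have iz : ∀ i, Integrable (fun z => dirDeriv (EuclideanSpace.single i 1) f (x + σ • z) *
      ⟪EuclideanSpace.single i (1 : ℝ), z⟫) γ := fun i => by
    obtain ⟨M, hM⟩ := (hf.bddC1_dirDeriv (EuclideanSpace.single i 1)).bdd
    exact (integrable_inner_stdGaussian _).bdd_mul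
      ((hf.bddC1_dirDeriv _).continuous.comp (by fun_prop)).aestronglyMeasurable
      (ae_of_all _ fun z => hM _)
  have e1 : ∀ z, fderiv ℝ f (x + σ • z) (W ω + (-r / σ) • z) =
      fderiv ℝ f (x + σ • z) (W ω) + (-r / σ) * ∑ i,
        dirDeriv (EuclideanSpace.single i 1) f (x + σ • z) *
          ⟪EuclideanSpace.single i (1 : ℝ), z⟫ := by
    intro z
    rw [map_add, map_smul, smul_eq_mul]
    congr 2
    rw [← dirDeriv, dirDeriv_eq_sum]
    simp [EuclideanSpace.inner_single_left, mul_comm]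
  refine (integral_congr_ae (ae_of_all _ e1)).trans ?_
  rw [integral_add (i1.apply_continuousLinearMap (W ω))
    ((integrable_finsetSum _ fun i _ => iz i).const_mul _), integral_const_mul,
    integral_finsetSum _ fun i _ => iz i, sub_eq_add_neg]
  congr 1
  · have : ∫ z, fderiv ℝ f (x + σ • z) (W ω) ∂γ = dirDeriv (W ω) (gaussianSmooth σ f) x := by
      rw [hf.bddC1.dirDeriv_gaussianSmooth]
      rfl
    rw [this, dirDeriv_eq_sum]
    refine Finset.sum_congr rfl fun i _ => ?_
    rw [hf.bddC1.dirDeriv_gaussianSmooth, mul_comm]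
  · simp_rw [hγ, (hf.bddC1_dirDeriv _).integral_mul_inner]
    rw [← Finset.mul_sum]
    field_simp

/-- The Stein pair controls the derivative of the interpolation. -/
lemma IsSteinPair.abs_deriv_interp_le (h : IsSteinPair P W W' lam E)
    (hT : Integrable (fun ω => ‖W' ω - W ω‖ ^ 3) P)
    {f : EuclideanSpace ℝ (Fin k) → ℝ} (hf : BddC3 f) {t r : ℝ} (ht : 0 < t)
    (hr : r ∈ Set.Ioo (0 : ℝ) 1) {m₂ m₃ : ℝ} (hm₂ : 0 ≤ m₂)
    (hHS : ∀ x, ∑ i, ∑ j, gaussianSmooth (interpStd t r) (dirDeriv (EuclideanSpace.single j 1)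
      (dirDeriv (EuclideanSpace.single i 1) f)) x ^ 2 ≤ m₂ ^ 2)
    (hLip : ∀ x y d, |gaussianSmooth (interpStd t r) (dirDeriv d (dirDeriv d f)) x -
      gaussianSmooth (interpStd t r) (dirDeriv d (dirDeriv d f)) y| ≤ m₃ * ‖d‖ ^ 2 * ‖x - y‖) :
    ∃ D, HasDerivAt (interp P W f t) D r ∧
      |D| ≤ (r * m₂ / 2 * ∫ ω, √(∑ i, ∑ j, E i j ω ^ 2) ∂P +
        r ^ 2 * m₃ / 6 * ∫ ω, ‖W' ω - W ω‖ ^ 3 ∂P) / lam := by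
  refine ⟨_, hasDerivAt_interp h.measurable h.integrable hf ht hr, ?_⟩
  set σ := interpStd t r with hσ
  set e : Fin k → EuclideanSpace ℝ (Fin k) := fun i => EuclideanSpace.single i 1 with he
  have hS := hf.gaussianSmooth σ
  have hd1 : ∀ v, dirDeriv v (gaussianSmooth σ f) = gaussianSmooth σ (dirDeriv v f) :=
    hf.bddC1.dirDeriv_gaussianSmooth σ
  have hd2 : ∀ v w, dirDeriv w (gaussianSmooth σ (dirDeriv v f)) =
      gaussianSmooth σ (dirDeriv w (dirDeriv v f)) :=
    fun v w => (hf.bddC1_dirDeriv v).dirDeriv_gaussianSmooth σ w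
  -- The Stein pair is tested against `x ↦ u (r x)`, where `u` is the Gaussian average of `f`.
  have key := h.abs_integral_stein_le hT (u := fun x => gaussianSmooth σ f (r • x))
    (G := fun i x => r * gaussianSmooth σ (dirDeriv (e i) f) (r • x))
    (H := fun i j x => r ^ 2 * gaussianSmooth σ (dirDeriv (e j) (dirDeriv (e i) f)) (r • x))
    (m₂ := r ^ 2 * m₂) (m₃ := r ^ 3 * m₃)
    (hS.bddC1.continuous.measurable.comp (measurable_const_smul r)) ?_ ?_ ?_ ?_ ?_
    (by positivity) ?_ ?_
  · have hr0 := hr.1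
    have e1 : ∀ ω, (∑ i, r ^ 2 * gaussianSmooth σ (dirDeriv (e i) (dirDeriv (e i) f)) (r • W ω) -
        ∑ i, r * gaussianSmooth σ (dirDeriv (e i) f) (r • W ω) * W ω i) =
        -r * (∑ i, gaussianSmooth σ (dirDeriv (e i) f) (r • W ω) * W ω i -
          r * ∑ i, gaussianSmooth σ (dirDeriv (e i) (dirDeriv (e i) f)) (r • W ω)) := by
      intro ω
      simp_rw [mul_assoc, ← Finset.mul_sum]
      ring
    simp_rw [e1] at key
    rw [integral_const_mul, abs_mul, abs_neg, abs_of_pos hr0, ← le_div_iff₀' hr0] at key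
    refine key.trans_eq ?_
    field_simp
  · obtain ⟨C, hC⟩ := hS.bddC1.bdd
    exact ⟨C, fun x => hC _⟩
  · intro i
    have := ((hf.bddC1_dirDeriv (e i)).gaussianSmooth σ).continuous
    exact (this.measurable.comp (measurable_const_smul r)).const_mul r
  · intro i
    obtain ⟨C, hC⟩ := ((hf.bddC1_dirDeriv (e i)).gaussianSmooth σ).bdd
    exact ⟨|r| * C, fun x => by rw [abs_mul]; gcongr; exact hC _⟩
  · intro i j
    have := ((hf.bddC1_dirDeriv_dirDeriv (e i) (e j)).gaussianSmooth σ).continuous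
    exact (this.measurable.comp (measurable_const_smul r)).const_mul _
  · intro i j
    obtain ⟨C, hC⟩ := ((hf.bddC1_dirDeriv_dirDeriv (e i) (e j)).gaussianSmooth σ).bdd
    exact ⟨|r ^ 2| * C, fun x => by rw [abs_mul]; gcongr; exact hC _⟩
  · intro x
    simp_rw [mul_pow _ (gaussianSmooth _ _ _), ← Finset.mul_sum]
    rw [mul_pow]
    gcongr
    exact hHS _
  · intro x d
    have ht := hS.abs_taylor_le (r • x) (r • d) (m := r ^ 3 * m₃ * ‖d‖ ^ 3) ?_
    · simp_rw [hd1, hd2] at ht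
      rw [← smul_add] at ht
      refine (le_of_eq ?_).trans (ht.trans_eq (by ring))
      congr 1
      simp only [PiLp.smul_apply, smul_eq_mul, Finset.mul_sum]
      congr 1
      · congr 1
        refine Finset.sum_congr rfl fun i _ => ?_
        ring
      · refine Finset.sum_congr rfl fun i _ => Finset.sum_congr rfl fun j _ => ?_
        ring
    · intro s hs
      rw [hd1, hd2]
      refine (hLip _ _ _).trans_eq ?_
      rw [add_sub_cancel_left, norm_smul, norm_smul, Real.norm_of_nonneg hs,
        norm_smul, Real.norm_of_nonneg hr.1.le]
      ring

lemma abs_sub_le_of_abs_deriv_le {φ B b : ℝ → ℝ} (hφ : ContinuousOn φ (Set.Icc 0 1))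
    (hB : ContinuousOn B (Set.Icc 0 1)) (hB' : ∀ r ∈ Set.Ioo (0 : ℝ) 1, HasDerivAt B (b r) r)
    (h : ∀ r ∈ Set.Ioo (0 : ℝ) 1, ∃ D, HasDerivAt φ D r ∧ |D| ≤ b r) :
    |φ 1 - φ 0| ≤ B 1 - B 0 := by
  have h1 : MonotoneOn (fun r => B r - φ r) (Set.Icc 0 1) := by
    refine monotoneOn_of_deriv_nonneg (convex_Icc 0 1) (hB.sub hφ) ?_ ?_ <;>
      rw [interior_Icc]
    · intro r hr
      obtain ⟨D, hD, _⟩ := h r hr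
      exact ((hB' r hr).sub hD).differentiableAt.differentiableWithinAt
    · intro r hr
      obtain ⟨D, hD, hDb⟩ := h r hr
      rw [((hB' r hr).fun_sub hD).deriv]
      linarith [le_abs_self D]
  have h2 : MonotoneOn (fun r => B r + φ r) (Set.Icc 0 1) := by
    refine monotoneOn_of_deriv_nonneg (convex_Icc 0 1) (hB.add hφ) ?_ ?_ <;>
      rw [interior_Icc]
    · intro r hr
      obtain ⟨D, hD, _⟩ := h r hr
      exact ((hB' r hr).add hD).differentiableAt.differentiableWithinAt
    · intro r hr
      obtain ⟨D, hD, hDb⟩ := h r hr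
      rw [((hB' r hr).fun_add hD).deriv]
      linarith [neg_abs_le D]
  have h3 := h1 (Set.left_mem_Icc.2 zero_le_one) (Set.right_mem_Icc.2 zero_le_one) zero_le_one
  have h4 := h2 (Set.left_mem_Icc.2 zero_le_one) (Set.right_mem_Icc.2 zero_le_one) zero_le_one
  simp only at h3 h4
  rw [abs_le]
  constructor <;> linarith

end Interpolation

/-! ### Comparison of the smoothed laws -/

section SmoothBounds

lemma sqrt_two_div_pi_le_one : √(2 / Real.pi) ≤ 1 := by
  rw [Real.sqrt_le_left zero_le_one, one_pow, div_le_one Real.pi_pos]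
  linarith [Real.pi_gt_three]

lemma sum_sq_dirDeriv_le {k : ℕ} {f : EuclideanSpace ℝ (Fin k) → ℝ} {L : ℝ}
    {x : EuclideanSpace ℝ (Fin k)} (hL : ∀ v, |dirDeriv v f x| ≤ L * ‖v‖) :
    ∑ i, dirDeriv (EuclideanSpace.single i 1) f x ^ 2 ≤ L ^ 2 := by
  set v : EuclideanSpace ℝ (Fin k) :=
    WithLp.toLp 2 fun i => dirDeriv (EuclideanSpace.single i 1) f x with hv
  have h1 : dirDeriv v f x = ‖v‖ ^ 2 := by
    rw [dirDeriv_eq_sum, EuclideanSpace.real_norm_sq_eq]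
    simp [hv, sq]
  have h2 : ∑ i, dirDeriv (EuclideanSpace.single i 1) f x ^ 2 = ‖v‖ ^ 2 := by
    rw [EuclideanSpace.real_norm_sq_eq]
  have h3 := hL v
  rw [h1, abs_of_nonneg (sq_nonneg _)] at h3
  rw [h2]
  rcases (norm_nonneg v).eq_or_lt with h0 | h0
  · rw [← h0, zero_pow two_ne_zero]; positivity
  · have : ‖v‖ ≤ L := by nlinarith
    gcongr

variable {k : ℕ}

lemma gaussianSmooth_interpStd {F : EuclideanSpace ℝ (Fin k) → ℝ} (hF : BddC1 F) {t r : ℝ}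
    (hr : r ∈ Set.Icc (0 : ℝ) 1) :
    gaussianSmooth (interpStd t r) F = gaussianSmooth √(1 - r ^ 2) (gaussianSmooth t F) := by
  obtain ⟨C, hC⟩ := hF.bdd
  ext x
  rw [gaussianSmooth_gaussianSmooth hF.continuous hC, interpStd, Real.sq_sqrt]
  nlinarith [hr.1, hr.2]

lemma gaussianSmooth_eq_of_sq_add_sq {F : EuclideanSpace ℝ (Fin k) → ℝ} (hF : BddC1 F)
    {a b c : ℝ} (hc : 0 ≤ c) (h : a ^ 2 + b ^ 2 = c ^ 2) :
    gaussianSmooth c F = gaussianSmooth a (gaussianSmooth b F) := by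
  obtain ⟨C, hC⟩ := hF.bdd
  ext x
  rw [gaussianSmooth_gaussianSmooth hF.continuous hC, h, Real.sqrt_sq hc]

lemma BddC1.abs_gaussianSmooth_dirDeriv_le' {F : EuclideanSpace ℝ (Fin k) → ℝ} (hF : BddC1 F)
    {σ M : ℝ} (hσ : 0 < σ) (hM : ∀ x, |F x| ≤ M) (x v : EuclideanSpace ℝ (Fin k)) :
    |_root_.gaussianSmooth σ (dirDeriv v F) x| ≤ M / σ * ‖v‖ := by
  have hM0 : 0 ≤ M := (abs_nonneg _).trans (hM 0)
  refine (hF.abs_gaussianSmooth_fderiv_le hσ hM x v).trans ?_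
  calc √(2 / Real.pi) * M * ‖v‖ / σ ≤ 1 * M * ‖v‖ / σ := by
        gcongr
        exact sqrt_two_div_pi_le_one
    _ = _ := by ring

/-- The third derivative of the average of a Lipschitz function: one Gaussian factor of standard
deviation `t` and one of standard deviation `√(1 - r²)` each absorb one derivative. -/
lemma BddC3.abs_gaussianSmooth_sub_le_of_lipschitz {f : EuclideanSpace ℝ (Fin k) → ℝ}
    (hf : BddC3 f) (hL : ∀ x v, |dirDeriv v f x| ≤ ‖v‖) {t r : ℝ} (ht : 0 < t)
    (hr : r ∈ Set.Ioo (0 : ℝ) 1) (x y d : EuclideanSpace ℝ (Fin k)) :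
    |_root_.gaussianSmooth (interpStd t r) (dirDeriv d (dirDeriv d f)) x -
      _root_.gaussianSmooth (interpStd t r) (dirDeriv d (dirDeriv d f)) y| ≤
    2 / Real.pi / (t * √(1 - r ^ 2)) * ‖d‖ ^ 2 * ‖x - y‖ := by
  have hs : 0 < √(1 - r ^ 2) := Real.sqrt_pos.2 (by nlinarith [hr.1, hr.2])
  have h2 := hf.bddC1_dirDeriv_dirDeriv d d
  rw [gaussianSmooth_interpStd h2 ⟨hr.1.le, hr.2.le⟩]
  refine ((h2.gaussianSmooth t).abs_gaussianSmooth_sub_le hs (fun z =>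
    (hf.bddC1_dirDeriv d).abs_gaussianSmooth_fderiv_le ht (hL · d) z d) x y).trans_eq ?_
  have : √(2 / Real.pi) * √(2 / Real.pi) = 2 / Real.pi := Real.mul_self_sqrt (by positivity)
  calc _ = √(2 / Real.pi) * √(2 / Real.pi) / (t * √(1 - r ^ 2)) * ‖d‖ ^ 2 * ‖x - y‖ := by
        field_simp
    _ = _ := by rw [this]

lemma BddC3.sum_sq_gaussianSmooth_le_of_lipschitz {f : EuclideanSpace ℝ (Fin k) → ℝ}
    (hf : BddC3 f) {L : ℝ} (hL : ∀ x v, |dirDeriv v f x| ≤ L * ‖v‖) {σ : ℝ} (hσ : 0 < σ)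
    (x : EuclideanSpace ℝ (Fin k)) :
    ∑ i, ∑ j, _root_.gaussianSmooth σ (dirDeriv (EuclideanSpace.single j 1)
      (dirDeriv (EuclideanSpace.single i 1) f)) x ^ 2 ≤ (L / σ) ^ 2 :=
  sum_sq_gaussianSmooth_fderiv_le (fun i => hf.bddC1_dirDeriv (EuclideanSpace.single i 1)) hσ
    (fun y => sum_sq_dirDeriv_le (hL y)) x

/-- The Gaussian of standard deviation `σ` is split into two independent ones of standard deviation
`σ / √2`; each absorbs one derivative. -/
lemma BddC3.sum_sq_gaussianSmooth_le_of_bounded {f : EuclideanSpace ℝ (Fin k) → ℝ}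
    (hf : BddC3 f) (hb : ∀ x, |f x| ≤ 1) {σ : ℝ} (hσ : 0 < σ) (x : EuclideanSpace ℝ (Fin k)) :
    ∑ i, ∑ j, _root_.gaussianSmooth σ (dirDeriv (EuclideanSpace.single j 1)
      (dirDeriv (EuclideanSpace.single i 1) f)) x ^ 2 ≤ (2 / σ ^ 2) ^ 2 := by
  have hs2 : √2 ^ 2 = 2 := Real.sq_sqrt (by norm_num)
  have hσ' : 0 < σ / √2 := by positivity
  have h := (hf.gaussianSmooth (σ / √2)).sum_sq_gaussianSmooth_le_of_lipschitz
    (L := 1 / (σ / √2)) (fun y v => ?_) hσ' x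
  · simp_rw [hf.bddC1.dirDeriv_gaussianSmooth, (hf.bddC1_dirDeriv _).dirDeriv_gaussianSmooth] at h
    simp_rw [gaussianSmooth_eq_of_sq_add_sq (hf.bddC1_dirDeriv_dirDeriv _ _) hσ.le
      (show (σ / √2) ^ 2 + (σ / √2) ^ 2 = σ ^ 2 by rw [div_pow, hs2]; ring)]
    refine h.trans_eq ?_
    congr 1
    rw [div_div, ← sq, div_pow, hs2]
    field_simp
  · rw [hf.bddC1.dirDeriv_gaussianSmooth]
    exact hf.bddC1.abs_gaussianSmooth_dirDeriv_le' hσ' hb y v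

/-- The Gaussian of standard deviation `σ` is split into three independent ones of standard
deviation `σ / √3`; each absorbs one derivative, and `√3 ^ 3 ≤ 6`. -/
lemma BddC3.abs_gaussianSmooth_sub_le_of_bounded {f : EuclideanSpace ℝ (Fin k) → ℝ}
    (hf : BddC3 f) (hb : ∀ x, |f x| ≤ 1) {σ : ℝ} (hσ : 0 < σ)
    (x y d : EuclideanSpace ℝ (Fin k)) :
    |_root_.gaussianSmooth σ (dirDeriv d (dirDeriv d f)) x -
      _root_.gaussianSmooth σ (dirDeriv d (dirDeriv d f)) y| ≤ 6 / σ ^ 3 * ‖d‖ ^ 2 * ‖x - y‖ := by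
  have hs3 : √3 ^ 2 = 3 := Real.sq_sqrt (by norm_num)
  set τ := σ / √3 with hτ
  have hτ0 : 0 < τ := by positivity
  have hτ2 : τ ^ 2 = σ ^ 2 / 3 := by rw [hτ, div_pow, hs3]
  have h2 := hf.bddC1_dirDeriv_dirDeriv d d
  have e : _root_.gaussianSmooth σ (dirDeriv d (dirDeriv d f)) =
      _root_.gaussianSmooth τ (_root_.gaussianSmooth τ
        (dirDeriv d (_root_.gaussianSmooth τ (dirDeriv d f)))) := by
    rw [(hf.bddC1_dirDeriv d).dirDeriv_gaussianSmooth, gaussianSmooth_eq_of_sq_add_sq h2 hσ.le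
      (a := √(τ ^ 2 + τ ^ 2)) (b := τ), gaussianSmooth_eq_of_sq_add_sq (h2.gaussianSmooth τ)
      (a := τ) (b := τ) (Real.sqrt_nonneg _)]
    · rw [Real.sq_sqrt (by positivity)]
    · rw [Real.sq_sqrt (by positivity), hτ2]
      ring
  have hF := (hf.bddC1_dirDeriv d).gaussianSmooth τ
  have hF' : BddC1 (dirDeriv d (_root_.gaussianSmooth τ (dirDeriv d f))) := by
    rw [(hf.bddC1_dirDeriv d).dirDeriv_gaussianSmooth]
    exact h2.gaussianSmooth τ
  have hF'' := hF'.gaussianSmooth τ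
  have hb1 := fun z => hf.bddC1.abs_gaussianSmooth_dirDeriv_le' hτ0 hb z d
  have hb2 := fun z => hF.abs_gaussianSmooth_dirDeriv_le' hτ0 hb1 z d
  rw [e]
  refine ((hF''.gaussianSmooth τ).abs_sub_le (fun z v => ?_) x y).trans
    (mul_le_mul_of_nonneg_right ?_ (norm_nonneg _) (b := 1 / τ * ‖d‖ / τ * ‖d‖ / τ))
  · rw [hF''.dirDeriv_gaussianSmooth]
    exact hF''.abs_gaussianSmooth_dirDeriv_le' hτ0 hb2 z v
  · have hτ3 : σ ^ 3 / 6 ≤ τ ^ 3 := by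
      have h1 : √3 ^ 3 ≤ 6 := by
        rw [pow_succ, hs3]
        have : √3 ≤ 2 := by rw [Real.sqrt_le_left (by norm_num)]; norm_num
        linarith
      rw [hτ, div_pow]
      gcongr
    calc 1 / τ * ‖d‖ / τ * ‖d‖ / τ = ‖d‖ ^ 2 / τ ^ 3 := by field_simp
      _ ≤ ‖d‖ ^ 2 / (σ ^ 3 / 6) := by gcongr
      _ = _ := by field_simp

variable {Ω : Type*} [MeasurableSpace Ω] {P : Measure Ω}
    {W W' : Ω → EuclideanSpace ℝ (Fin k)} {lam : ℝ} {E : Fin k → Fin k → Ω → ℝ}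

lemma interp_one {f : EuclideanSpace ℝ (Fin k) → ℝ} {t : ℝ} (ht : 0 ≤ t) :
    interp P W f t 1 = ∫ ω, gaussianSmooth t f (W ω) ∂P := by
  simp [interp, interpStd, Real.sqrt_sq ht]

variable [IsProbabilityMeasure P]

lemma interp_zero {f : EuclideanSpace ℝ (Fin k) → ℝ} {t : ℝ} :
    interp P W f t 0 = gaussianSmooth √(1 + t ^ 2) f 0 := by
  simp [interp, interpStd]

/-- Comparison of the Gaussian-smoothed laws on `1`-Lipschitz functions. -/
lemma IsSteinPair.abs_integral_gaussianSmooth_sub_le_of_lipschitz (h : IsSteinPair P W W' lam E)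
    (hT : Integrable (fun ω => ‖W' ω - W ω‖ ^ 3) P) {f : EuclideanSpace ℝ (Fin k) → ℝ}
    (hf : BddC3 f) (hL : ∀ x v, |dirDeriv v f x| ≤ ‖v‖) {t : ℝ} (ht : 0 < t) :
    |∫ ω, gaussianSmooth t f (W ω) ∂P - gaussianSmooth √(1 + t ^ 2) f 0| ≤
      (1 / 2 * ∫ ω, √(∑ i, ∑ j, E i j ω ^ 2) ∂P +
        1 / (12 * t) * ∫ ω, ‖W' ω - W ω‖ ^ 3 ∂P) / lam := by
  have hlam := h.lam_pos
  rw [← interp_one (W := W) ht.le, ← interp_zero (P := P) (W := W)]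
  set e := ∫ ω, √(∑ i, ∑ j, E i j ω ^ 2) ∂P with he
  set T := ∫ ω, ‖W' ω - W ω‖ ^ 3 ∂P with hT'
  have he0 : 0 ≤ e := integral_nonneg fun ω => Real.sqrt_nonneg _
  have hT0 : 0 ≤ T := integral_nonneg fun ω => by positivity
  have hcont : ContinuousOn (interpStd t) (Set.Icc 0 1) := fun r hr =>
      (hasDerivAt_interpStd ht hr).continuousAt.continuousWithinAt
  -- The second summand of the majorant is a primitive of `r ^ 2 / √(1 - r ^ 2)`.
  refine (abs_sub_le_of_abs_deriv_le (B := fun r => (-interpStd t r / 2 * e +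
      (2 / Real.pi / t * ((Real.arcsin r - r * √(1 - r ^ 2)) / 2)) / 6 * T) / lam)
    (b := fun r => (r * (1 / interpStd t r) / 2 * e +
      r ^ 2 * (2 / Real.pi / (t * √(1 - r ^ 2))) / 6 * T) / lam)
    (continuousOn_interp h.measurable hf.bddC1 ht) ?_ ?_ ?_).trans ?_
  · have h1 : Continuous fun r : ℝ => (Real.arcsin r - r * √(1 - r ^ 2)) / 2 := by
      have := Real.continuous_arcsin
      fun_prop
    exact ((((hcont.neg.div_const 2).mul continuousOn_const).add
      (((h1.continuousOn.const_mul _).div_const 6).mul continuousOn_const)).div_const lam)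
  · intro r hr
    have hr' : 0 < 1 - r ^ 2 := by nlinarith [hr.1, hr.2]
    have hs := Real.sqrt_pos.2 hr'
    have hsq : √(1 - r ^ 2) ^ 2 = 1 - r ^ 2 := Real.sq_sqrt hr'.le
    have h1 := hasDerivAt_interpStd (t := t) ht ⟨hr.1.le, hr.2.le⟩
    have h2 := Real.hasDerivAt_arcsin (x := r) (by linarith [hr.1]) (by linarith [hr.2])
    have h3 : HasDerivAt (fun r : ℝ => 1 - r ^ 2) (-(2 * r)) r := by
      simpa using (hasDerivAt_pow 2 r).const_sub 1
    have h4 := (hasDerivAt_id' r).mul (h3.sqrt hr'.ne')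
    have h5 := ((((h2.sub h4).div_const 2).const_mul (2 / Real.pi / t)).div_const 6).mul_const T
    refine ((((h1.neg.div_const 2).mul_const e).add h5).div_const lam).congr_deriv ?_
    congr 1
    congr 1
    · ring
    · field_simp
      rw [hsq]
      ring
  · intro r hr
    have hσ : 0 < interpStd t r := ht.trans_le (le_interpStd ⟨hr.1.le, hr.2.le⟩)
    exact h.abs_deriv_interp_le hT hf ht hr (by positivity)
      (hf.sum_sq_gaussianSmooth_le_of_lipschitz (by simpa using hL) hσ)
      (hf.abs_gaussianSmooth_sub_le_of_lipschitz hL ht hr)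
  · rw [← sub_div]
    gcongr
    have h1 : interpStd t 1 = t := by simp [interpStd, Real.sqrt_sq ht.le]
    have h0 : interpStd t 0 ≤ 1 + t := by
      rw [interpStd, Real.sqrt_le_left (by positivity)]
      nlinarith
    rw [h1]
    simp only [Real.arcsin_one, Real.arcsin_zero]
    have e1 : 2 / Real.pi / t * ((Real.pi / 2 - 1 * √(1 - 1 ^ 2)) / 2) / 6 = 1 / (12 * t) := by
      have := Real.pi_pos.ne'
      simp
      field_simp
      norm_num
    rw [e1]
    simp only [zero_mul, sub_zero, zero_div, mul_zero, add_zero]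
    nlinarith

/-- Comparison of the Gaussian-smoothed laws on functions bounded by `1`. -/
lemma IsSteinPair.abs_integral_gaussianSmooth_sub_le_of_bounded (h : IsSteinPair P W W' lam E)
    (hT : Integrable (fun ω => ‖W' ω - W ω‖ ^ 3) P) {f : EuclideanSpace ℝ (Fin k) → ℝ}
    (hf : BddC3 f) (hb : ∀ x, |f x| ≤ 1) {t : ℝ} (ht : 0 < t) :
    |∫ ω, gaussianSmooth t f (W ω) ∂P - gaussianSmooth √(1 + t ^ 2) f 0| ≤
      (2 / √t * ∫ ω, √(∑ i, ∑ j, E i j ω ^ 2) ∂P +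
        1 / t * ∫ ω, ‖W' ω - W ω‖ ^ 3 ∂P) / lam := by
  have hlam := h.lam_pos
  rw [← interp_one (W := W) ht.le, ← interp_zero (P := P) (W := W)]
  set e := ∫ ω, √(∑ i, ∑ j, E i j ω ^ 2) ∂P with he
  set T := ∫ ω, ‖W' ω - W ω‖ ^ 3 ∂P with hT'
  have he0 : 0 ≤ e := integral_nonneg fun ω => Real.sqrt_nonneg _
  have hT0 : 0 ≤ T := integral_nonneg fun ω => by positivity
  have hpos : ∀ r ∈ Set.Icc (0 : ℝ) 1, 0 < interpStd t r := fun r hr =>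
    ht.trans_le (le_interpStd hr)
  have hB : ∀ r ∈ Set.Icc (0 : ℝ) 1, HasDerivAt (fun r => (-Real.log (interpStd t r) * e +
      (interpStd t r)⁻¹ * T) / lam)
      ((r / interpStd t r ^ 2 * e + r / interpStd t r ^ 3 * T) / lam) r := by
    intro r hr
    have h1 := hasDerivAt_interpStd ht hr
    have hσ := hpos r hr
    refine ((((h1.log hσ.ne').neg.mul_const e).add
      ((h1.inv hσ.ne').mul_const T)).div_const lam).congr_deriv ?_
    congr 1
    field_simp
  refine (abs_sub_le_of_abs_deriv_le (continuousOn_interp h.measurable hf.bddC1 ht)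
    (fun r hr => (hB r hr).continuousAt.continuousWithinAt)
    (fun r hr => hB r ⟨hr.1.le, hr.2.le⟩) ?_).trans ?_
  · intro r hr
    have hσ := hpos r ⟨hr.1.le, hr.2.le⟩
    obtain ⟨D, hD, hle⟩ := h.abs_deriv_interp_le hT hf ht hr (by positivity)
      (hf.sum_sq_gaussianSmooth_le_of_bounded hb hσ)
      (hf.abs_gaussianSmooth_sub_le_of_bounded hb hσ)
    refine ⟨D, hD, hle.trans ?_⟩
    have hr0 := hr.1
    have hr2 : r ^ 2 ≤ r := by nlinarith [hr.1, hr.2]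
    refine div_le_div_of_nonneg_right (add_le_add (mul_le_mul_of_nonneg_right ?_ he0)
      (mul_le_mul_of_nonneg_right ?_ hT0)) hlam.le
    · exact le_of_eq (by ring)
    · calc r ^ 2 * (6 / interpStd t r ^ 3) / 6 = r ^ 2 / interpStd t r ^ 3 := by ring
        _ ≤ _ := by gcongr
  · rw [← sub_div]
    gcongr
    have h1 : interpStd t 1 = t := by simp [interpStd, Real.sqrt_sq ht.le]
    have h0 := hpos 0 (by simp)
    have hi : 0 ≤ (interpStd t 0)⁻¹ * T := by positivity
    have hlog : Real.log (interpStd t 0) - Real.log t ≤ 2 / √t := by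
      -- With `q = √t`, the ratio `√(1 + t ^ 2) / t` is at most `(1 + 1 / q) ^ 2`.
      have hq : 0 < √t := Real.sqrt_pos.2 ht
      have hq2 : √t ^ 2 = t := Real.sq_sqrt ht.le
      have h2 : interpStd t 0 ≤ t * (1 + 1 / √t) ^ 2 := by
        have : t * (1 + 1 / √t) ^ 2 = t + 2 * √t + 1 := by
          field_simp
          linear_combination (-(1 + 2 * √t)) * hq2
        rw [this, interpStd, Real.sqrt_le_left (by positivity)]
        nlinarith
      have h3 := Real.log_le_log h0 h2
      rw [Real.log_mul ht.ne' (by positivity), Real.log_pow] at h3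
      have h4 := Real.log_le_sub_one_of_pos (show 0 < 1 + 1 / √t by positivity)
      have h5 : 2 / √t = 2 * (1 / √t) := by ring
      rw [h5]
      push_cast at h3
      linarith
    rw [h1, one_div]
    nlinarith

end SmoothBounds

/-! ### Reduction to smooth test functions -/

section TestFunctions

lemma abs_integral_sub_le_of_forall_abs_sub_le {X : Type*} [MeasurableSpace X]
    {μ : Measure X} [IsProbabilityMeasure μ]
    {f g : X → ℝ} (hf : Integrable f μ) (hg : Integrable g μ) {ε : ℝ}
    (h : ∀ x, |f x - g x| ≤ ε) : |∫ x, f x ∂μ - ∫ x, g x ∂μ| ≤ ε := by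
  rw [← integral_sub hf hg]
  simpa using norm_integral_le_of_norm_le_const (μ := μ) (f := fun x => f x - g x)
    (ae_of_all _ h)

variable {X : Type*} [NormedAddCommGroup X] [InnerProductSpace ℝ X]

lemma BddC1.of_hasCompactSupport {f : X → ℝ} (hf : ContDiff ℝ (⊤ : ℕ∞) f)
    (hc : HasCompactSupport f) : BddC1 f := by
  refine ⟨hf.of_le (mod_cast le_top), ?_, ?_⟩
  · exact hc.exists_bound_of_continuous hf.continuous
  · exact (hc.fderiv (𝕜 := ℝ)).exists_bound_of_continuous (hf.continuous_fderiv (by simp))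

lemma BddC3.of_hasCompactSupport {f : X → ℝ} (hf : ContDiff ℝ (⊤ : ℕ∞) f)
    (hc : HasCompactSupport f) : BddC3 f := by
  have h1 : ∀ {g : X → ℝ}, ContDiff ℝ (⊤ : ℕ∞) g → ∀ v, ContDiff ℝ (⊤ : ℕ∞) (dirDeriv v g) :=
    fun hg v => (hg.fderiv_right (m := (⊤ : ℕ∞)) le_rfl).clm_apply contDiff_const
  have h2 : ∀ {g : X → ℝ}, HasCompactSupport g → ∀ v, HasCompactSupport (dirDeriv v g) :=
    fun hg v => hg.fderiv_apply (𝕜 := ℝ) v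
  exact ⟨.of_hasCompactSupport hf hc, fun v => .of_hasCompactSupport (h1 hf v) (h2 hc v),
    fun v w => .of_hasCompactSupport (h1 (h1 hf v) w) (h2 (h2 hc v) w)⟩

variable [FiniteDimensional ℝ X] [MeasurableSpace X] [BorelSpace X]

/-- Convolution with a smooth bump approximates a continuous function of compact support uniformly
by smooth ones, and preserves bounds and the Lipschitz constant. -/
lemma exists_contDiff_approx {g : X → ℝ} (hg : Continuous g) (hc : HasCompactSupport g) {ε : ℝ}
    (hε : 0 < ε) :
    ∃ φ : X → ℝ, ContDiff ℝ (⊤ : ℕ∞) φ ∧ HasCompactSupport φ ∧ (∀ x, |φ x - g x| ≤ ε) ∧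
      ((∀ x, g x ∈ Set.Icc 0 1) → ∀ x, φ x ∈ Set.Icc 0 1) ∧
      (LipschitzWith 1 g → LipschitzWith 1 φ) := by
  obtain ⟨δ, hδ, hgδ⟩ := Metric.uniformContinuous_iff.1
    (hg.uniformContinuous_of_tendsto_cocompact hc.is_zero_at_infty) ε hε
  set b : ContDiffBump (0 : X) := ⟨δ / 2, δ, half_pos hδ, half_lt_self hδ⟩ with hb
  have hval : ∀ x, convolution (b.normed volume) g (ContinuousLinearMap.lsmul ℝ ℝ) volume x =
      ∫ z, b.normed volume z * g (x - z) := fun x => rfl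
  obtain ⟨C, hC⟩ := hc.exists_bound_of_continuous hg
  have hint : ∀ x, Integrable (fun z => b.normed volume z * g (x - z)) := fun x =>
    b.integrable_normed.mul_bdd (hg.comp (by fun_prop)).aestronglyMeasurable
      (ae_of_all _ fun z => hC _)
  refine ⟨convolution (b.normed volume) g (ContinuousLinearMap.lsmul ℝ ℝ) volume,
    b.hasCompactSupport_normed.contDiff_convolution_left _ b.contDiff_normed hg.locallyIntegrable,
    b.hasCompactSupport_normed.convolution _ hc, fun x => ?_, fun h x => ?_, fun h => ?_⟩
  · exact b.dist_normed_convolution_le hg.aestronglyMeasurable fun y hy => (hgδ hy).le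
  · rw [hval]
    constructor
    · exact integral_nonneg fun z => mul_nonneg (b.nonneg_normed z) (h _).1
    · rw [← b.integral_normed (μ := volume)]
      exact integral_mono (hint x) b.integrable_normed fun z =>
        mul_le_of_le_one_right (b.nonneg_normed z) (h _).2
  · refine LipschitzWith.of_dist_le_mul fun x y => ?_
    rw [Real.dist_eq, hval, hval, ← integral_sub (hint x) (hint y), NNReal.coe_one, one_mul,
      ← mul_one (dist x y), ← b.integral_normed (μ := volume), ← integral_const_mul]
    refine norm_integral_le_of_norm_le
      (f := fun z => b.normed volume z * g (x - z) - b.normed volume z * g (y - z))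
      (b.integrable_normed.const_mul _) (ae_of_all _ fun z => ?_)
    rw [← mul_sub, norm_mul, Real.norm_of_nonneg (b.nonneg_normed z), mul_comm]
    refine mul_le_mul_of_nonneg_right ?_ (b.nonneg_normed z)
    simpa [Real.dist_eq] using h.dist_le_mul (x - z) (y - z)

/-- Smooth test functions of compact support suffice to bound the difference of the integrals of a
Lipschitz function. -/
lemma abs_integral_sub_le_of_forall_contDiff_lipschitz {μ ν : Measure X} [IsProbabilityMeasure μ]
    [IsProbabilityMeasure ν] (hμ : Integrable (fun x => ‖x‖) μ) (hν : Integrable (fun x => ‖x‖) ν)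
    {D : ℝ} (hD : ∀ φ : X → ℝ, ContDiff ℝ (⊤ : ℕ∞) φ → HasCompactSupport φ → LipschitzWith 1 φ →
      |∫ x, φ x ∂μ - ∫ x, φ x ∂ν| ≤ D) {f : X → ℝ} (hf : LipschitzWith 1 f) :
    |∫ x, f x ∂μ - ∫ x, f x ∂ν| ≤ D := by
  have step1 : ∀ g : X → ℝ, HasCompactSupport g → LipschitzWith 1 g →
      |∫ x, g x ∂μ - ∫ x, g x ∂ν| ≤ D := by
    intro g hc hg
    refine le_of_forall_pos_le_add fun ε hε => ?_
    obtain ⟨φ, h1, h2, h3, -, h5⟩ := exists_contDiff_approx hg.continuous hc (half_pos hε)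
    have hi : ∀ (ρ : Measure X) [IsProbabilityMeasure ρ],
        |∫ x, φ x ∂ρ - ∫ x, g x ∂ρ| ≤ ε / 2 := fun ρ _ =>
      abs_integral_sub_le_of_forall_abs_sub_le (h1.continuous.integrable_of_hasCompactSupport h2)
        (hg.continuous.integrable_of_hasCompactSupport hc) h3
    have h6 := abs_le.1 (hD φ h1 h2 (h5 hg))
    have h7 := abs_le.1 (hi μ)
    have h8 := abs_le.1 (hi ν)
    rw [abs_le]
    constructor <;> linarith [h6.1, h6.2, h7.1, h7.2, h8.1, h8.2]
  -- Clamp `f` between `-a N` and `a N`.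
  set a : ℕ → X → ℝ := fun N x => max 0 (N - ‖x‖) with ha
  set g : ℕ → X → ℝ := fun N x => max (-(a N x)) (min (f x) (a N x)) with hgdef
  have ha0 : ∀ N x, 0 ≤ a N x := fun N x => le_max_left _ _
  have haL : ∀ N, LipschitzWith 1 (a N) := by
    intro N
    have h1 : LipschitzWith 1 (fun x : X => (N : ℝ) - ‖x‖) := by
      refine LipschitzWith.of_dist_le_mul fun x y => ?_
      rw [Real.dist_eq, NNReal.coe_one, one_mul, dist_eq_norm, sub_sub_sub_cancel_left,
        norm_sub_rev]
      exact abs_norm_sub_norm_le y x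
    exact h1.const_max 0
  have hgL : ∀ N, LipschitzWith 1 (g N) := by
    intro N
    simpa using (haL N).neg.max (hf.min (haL N))
  have hgf : ∀ N x, |g N x| ≤ |f x| := by
    intro N x
    have := ha0 N x
    simp only [hgdef]
    rcases le_total (f x) (a N x) with h1 | h1
    · rw [min_eq_left h1]
      rcases le_total (-(a N x)) (f x) with h2 | h2
      · rw [max_eq_right h2]
      · rw [max_eq_left h2, abs_neg, abs_of_nonneg this, abs_of_nonpos (by linarith)]
        linarith
    · rw [min_eq_right h1, max_eq_right (by linarith), abs_of_nonneg this,
        abs_of_nonneg (by linarith)]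
      exact h1
  have hgc : ∀ N, HasCompactSupport (g N) := by
    intro N
    refine HasCompactSupport.intro (isCompact_closedBall (0 : X) N) fun x hx => ?_
    rw [mem_closedBall_zero_iff, not_le] at hx
    have : a N x = 0 := max_eq_left (by linarith)
    simp [hgdef, this]
  have hlim : ∀ x, Tendsto (fun N => g N x) atTop (𝓝 (f x)) := by
    intro x
    refine tendsto_const_nhds.congr' ?_
    obtain ⟨N₀, hN₀⟩ := exists_nat_ge (|f x| + ‖x‖)
    filter_upwards [eventually_ge_atTop N₀] with N hN
    have h1 : |f x| ≤ a N x := by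
      have : (N₀ : ℝ) ≤ N := by exact_mod_cast hN
      exact le_max_of_le_right (by linarith)
    have h2 := abs_le.1 h1
    simp only [hgdef]
    rw [min_eq_left h2.2, max_eq_right h2.1]
  have hlimi : ∀ (ρ : Measure X) [IsProbabilityMeasure ρ], Integrable (fun x => ‖x‖) ρ →
      Tendsto (fun N => ∫ x, g N x ∂ρ) atTop (𝓝 (∫ x, f x ∂ρ)) := by
    intro ρ _ hρ
    refine tendsto_integral_of_dominated_convergence (fun x => |f 0| + ‖x‖)
      (fun N => (hgL N).continuous.aestronglyMeasurable) ((integrable_const _).add hρ)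
      (fun N => ae_of_all _ fun x => ?_) (ae_of_all _ hlim)
    refine (hgf N x).trans ?_
    have := hf.dist_le_mul x 0
    rw [Real.dist_eq, NNReal.coe_one, one_mul, dist_zero_right] at this
    have h2 := abs_sub_abs_le_abs_sub (f x) (f 0)
    linarith
  exact le_of_tendsto ((hlimi μ hμ).sub (hlimi ν hν)).abs
    (Eventually.of_forall fun N => step1 _ (hgc N) (hgL N))

/-- Smooth test functions of compact support with values in `[0, 1]` suffice to bound the difference
of the measures of a set. -/
lemma abs_measureReal_sub_le_of_forall_contDiff {μ ν : Measure X} [IsProbabilityMeasure μ]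
    [IsProbabilityMeasure ν]
    {D : ℝ} (hD : ∀ φ : X → ℝ, ContDiff ℝ (⊤ : ℕ∞) φ → HasCompactSupport φ →
      (∀ x, φ x ∈ Set.Icc 0 1) → |∫ x, φ x ∂μ - ∫ x, φ x ∂ν| ≤ D)
    {A : Set X} (hA : MeasurableSet A) :
    |μ.real A - ν.real A| ≤ D := by
  refine le_of_forall_pos_le_add fun ε hε => ?_
  have hε4 : ENNReal.ofReal (ε / 8) ≠ 0 := by simpa using by positivity
  obtain ⟨U, hAU, hUo, -, hU⟩ := hA.exists_isOpen_sdiff_lt (measure_ne_top (μ + ν) A) hε4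
  obtain ⟨K, hKA, hKc, hK⟩ := hA.exists_isCompact_sdiff_lt (measure_ne_top (μ + ν) A) hε4
  obtain ⟨g, hgK, hgU, hgc, hg01⟩ := exists_continuous_one_zero_of_isCompact hKc
    hUo.isClosed_compl (Set.disjoint_compl_right_iff_subset.2 (hKA.trans hAU))
  obtain ⟨φ, h1, h2, h3, h4, -⟩ := exists_contDiff_approx g.continuous hgc
    (show 0 < ε / 4 by positivity)
  have hUK : (μ + ν).real (U \ K) ≤ ε / 4 := by
    have hsub : U \ K ⊆ (U \ A) ∪ (A \ K) := by
      intro x hx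
      by_cases hxA : x ∈ A
      · exact Or.inr ⟨hxA, hx.2⟩
      · exact Or.inl ⟨hx.1, hxA⟩
    have hle : (μ + ν) (U \ K) ≤ ENNReal.ofReal (ε / 4) := by
      calc (μ + ν) (U \ K) ≤ (μ + ν) (U \ A) + (μ + ν) (A \ K) :=
            (measure_mono hsub).trans (measure_union_le _ _)
        _ ≤ ENNReal.ofReal (ε / 8) + ENNReal.ofReal (ε / 8) := by gcongr
        _ = _ := by
          rw [← ENNReal.ofReal_add (by positivity) (by positivity)]
          congr 1
          ring
    exact ENNReal.toReal_le_of_le_ofReal (by positivity) hle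
  have hi : ∀ (ρ : Measure X) [IsProbabilityMeasure ρ], ρ ≤ μ + ν →
      |∫ x, φ x ∂ρ - ρ.real A| ≤ ε / 2 := by
    intro ρ _ hρ
    have hUK' : ρ.real (U \ K) ≤ ε / 4 :=
      (ENNReal.toReal_mono (measure_ne_top _ _) (hρ _)).trans hUK
    have hm : MeasurableSet (U \ K) := hUo.measurableSet.diff hKc.measurableSet
    have hgi : Integrable g ρ := g.continuous.integrable_of_hasCompactSupport hgc
    have e1 := abs_integral_sub_le_of_forall_abs_sub_le (μ := ρ)
      (h1.continuous.integrable_of_hasCompactSupport h2) hgi h3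
    have hAi : Integrable (A.indicator (1 : X → ℝ)) ρ :=
      (integrable_indicator_iff hA).2 (integrable_const (1 : ℝ)).integrableOn
    have e2 : |∫ x, g x ∂ρ - ρ.real A| ≤ ε / 4 := by
      rw [← integral_indicator_one hA, ← integral_sub hgi hAi]
      refine le_trans ?_ hUK'
      rw [← integral_indicator_one hm]
      refine norm_integral_le_of_norm_le (f := fun x => g x - A.indicator 1 x)
        ((integrable_indicator_iff hm).2 (integrable_const _).integrableOn)
        (ae_of_all _ fun x => ?_)
      rw [Real.norm_eq_abs]
      have h01 := hg01 x
      by_cases hxK : x ∈ K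
      · have : g x = 1 := hgK hxK
        simp [this, hKA hxK, hxK]
      · by_cases hxU : x ∈ U
        · rw [Set.indicator_of_mem (show x ∈ U \ K from ⟨hxU, hxK⟩)]
          by_cases hxA : x ∈ A
          · rw [Set.indicator_of_mem hxA, abs_le]
            simp only [Pi.one_apply]
            constructor <;> linarith [h01.1, h01.2]
          · rw [Set.indicator_of_notMem hxA, abs_le]
            simp only [Pi.one_apply]
            constructor <;> linarith [h01.1, h01.2]
        · have : g x = 0 := hgU hxU
          have hxA : x ∉ A := fun h => hxU (hAU h)
          simp [this, hxA, hxU]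
    rw [abs_le] at *
    constructor <;> linarith [e1.1, e1.2, e2.1, e2.2]
  have i1 := abs_le.1 (hi μ (Measure.le_add_right le_rfl))
  have i2 := abs_le.1 (hi ν (Measure.le_add_left le_rfl))
  have i3 := abs_le.1 (hD φ h1 h2 (h4 hg01))
  rw [abs_le]
  constructor <;> linarith [i1.1, i1.2, i2.1, i2.2, i3.1, i3.2]

end TestFunctions

/-! ### The Wasserstein bound -/

section Wasserstein

variable {k : ℕ} {Ω : Type*} [MeasurableSpace Ω] {P : Measure Ω} [IsProbabilityMeasure P]
    {W W' : Ω → EuclideanSpace ℝ (Fin k)} {lam : ℝ} {E : Fin k → Fin k → Ω → ℝ}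

lemma abs_dirDeriv_le_of_lipschitz {X : Type*} [NormedAddCommGroup X] [InnerProductSpace ℝ X]
    {f : X → ℝ} (hf : LipschitzWith 1 f) (x v : X) : |dirDeriv v f x| ≤ ‖v‖ := by
  refine (ContinuousLinearMap.le_opNorm (fderiv ℝ f x) v).trans ?_
  have := norm_fderiv_le_of_lipschitz ℝ hf (x₀ := x)
  rw [NNReal.coe_one] at this
  exact mul_le_of_le_one_left (norm_nonneg v) this

/-- The optimal choice of the smoothing parameter. -/
lemma le_of_forall_smoothing_le {D A a B : ℝ} (ha : 0 < a) (hB : 0 ≤ B)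
    (h : ∀ t : ℝ, 0 < t → D ≤ 2 * t * a + A + B / (12 * t)) : D ≤ A + √(2 / 3 * a * B) := by
  rcases hB.eq_or_lt with rfl | hB
  · simp only [mul_zero, Real.sqrt_zero, add_zero]
    refine le_of_forall_pos_le_add fun ε hε => ?_
    have := h (ε / (2 * a)) (by positivity)
    rw [zero_div, add_zero] at this
    refine this.trans_eq ?_
    field_simp
    ring
  · set t := √(B / (24 * a)) with ht
    have ht0 : 0 < t := Real.sqrt_pos.2 (by positivity)
    have ht2 : t ^ 2 = B / (24 * a) := Real.sq_sqrt (by positivity)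
    have hB' : B = 24 * a * t ^ 2 := by rw [ht2]; field_simp
    have h1 : √(2 / 3 * a * B) = 4 * t * a := by
      rw [hB', show 2 / 3 * a * (24 * a * t ^ 2) = (4 * t * a) ^ 2 by ring,
        Real.sqrt_sq (by positivity)]
    rw [h1]
    refine (h t ht0).trans_eq ?_
    rw [hB']
    field_simp
    ring

/-- The bound in the `L¹`-Wasserstein distance. -/
lemma IsSteinPair.abs_integral_sub_le (h : IsSteinPair P W W' lam E) (hk : 0 < k)
    (hT : Integrable (fun ω => ‖W' ω - W ω‖ ^ 3) P) {f : EuclideanSpace ℝ (Fin k) → ℝ}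
    (hf : LipschitzWith 1 f) :
    |∫ x, f x ∂(P.map W) - ∫ x, f x ∂stdGaussian (EuclideanSpace ℝ (Fin k))| ≤
      1 / lam * ∫ ω, √(∑ i, ∑ j, E i j ω ^ 2) ∂P +
        √(2 / 3 * √k * (1 / lam * ∫ ω, ‖W' ω - W ω‖ ^ 3 ∂P)) := by
  have hlam := h.lam_pos
  have hW := h.measurable
  have : IsProbabilityMeasure (P.map W) := Measure.isProbabilityMeasure_map hW.aemeasurable
  set e := ∫ ω, √(∑ i, ∑ j, E i j ω ^ 2) ∂P with he
  set T := ∫ ω, ‖W' ω - W ω‖ ^ 3 ∂P with hT'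
  have he0 : 0 ≤ e := integral_nonneg fun ω => Real.sqrt_nonneg _
  have hT0 : 0 ≤ T := integral_nonneg fun ω => by positivity
  have hμ : Integrable (fun x => ‖x‖) (P.map W) :=
    (integrable_map_measure (by fun_prop) hW.aemeasurable).2 h.integrable.norm
  refine abs_integral_sub_le_of_forall_contDiff_lipschitz hμ integrable_norm_stdGaussian
    (fun φ hφ hφc hφL => ?_) hf
  have hφ3 := BddC3.of_hasCompactSupport hφ hφc
  have hφ1 := hφ3.bddC1
  refine le_of_forall_smoothing_le (Real.sqrt_pos.2 (by exact_mod_cast hk)) (by positivity)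
    fun t ht => ?_
  have hsm : ∀ (σ : ℝ), 0 ≤ σ → ∀ x, |gaussianSmooth σ φ x - φ x| ≤ σ * √k := by
    intro σ hσ x
    have hi : Integrable (fun z => φ (x + σ • z)) (stdGaussian (EuclideanSpace ℝ (Fin k))) := by
      obtain ⟨C, hC⟩ := hφ1.bdd
      exact Integrable.of_bound (hφ1.continuous.comp (by fun_prop)).aestronglyMeasurable C
        (ae_of_all _ fun z => hC _)
    have e1 : gaussianSmooth σ φ x - φ x =
        ∫ z, (φ (x + σ • z) - φ x) ∂stdGaussian (EuclideanSpace ℝ (Fin k)) := by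
      rw [integral_sub hi (integrable_const _)]
      simp [gaussianSmooth]
    rw [e1]
    refine (norm_integral_le_of_norm_le (f := fun z => φ (x + σ • z) - φ x)
      (integrable_norm_stdGaussian.const_mul σ) (ae_of_all _ fun z => ?_)).trans ?_
    · have := hφL.dist_le_mul (x + σ • z) x
      simpa [Real.dist_eq, dist_eq_norm, norm_smul, abs_of_nonneg hσ] using this
    · rw [integral_const_mul]
      gcongr
      exact integral_norm_stdGaussian_le
  have e1 : |∫ ω, gaussianSmooth t φ (W ω) ∂P - ∫ ω, φ (W ω) ∂P| ≤ t * √k := by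
    have := abs_integral_sub_le_of_forall_abs_sub_le (μ := P.map W)
      (f := gaussianSmooth t φ) (g := φ) ?_ (hφ.continuous.integrable_of_hasCompactSupport hφc)
      (hsm t ht.le)
    · rwa [integral_map hW.aemeasurable
        (hφ1.gaussianSmooth t).continuous.aestronglyMeasurable,
        integral_map hW.aemeasurable hφ.continuous.aestronglyMeasurable] at this
    · obtain ⟨C, hC⟩ := (hφ1.gaussianSmooth t).bdd
      exact Integrable.of_bound (hφ1.gaussianSmooth t).continuous.aestronglyMeasurable C
        (ae_of_all _ hC)
  have e2 := h.abs_integral_gaussianSmooth_sub_le_of_lipschitz hT hφ3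
    (abs_dirDeriv_le_of_lipschitz hφL) ht
  have e3 : |gaussianSmooth √(1 + t ^ 2) φ 0 -
      ∫ x, φ x ∂stdGaussian (EuclideanSpace ℝ (Fin k))| ≤ t * √k := by
    have hi : ∀ σ : ℝ, Integrable (fun z => φ (0 + σ • z))
        (stdGaussian (EuclideanSpace ℝ (Fin k))) := by
      intro σ
      obtain ⟨C, hC⟩ := hφ1.bdd
      exact Integrable.of_bound (hφ1.continuous.comp (by fun_prop)).aestronglyMeasurable C
        (ae_of_all _ fun z => hC _)
    have h1 : 1 ≤ √(1 + t ^ 2) := Real.one_le_sqrt.2 (by nlinarith)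
    have h2 : √(1 + t ^ 2) ≤ 1 + t := by
      rw [Real.sqrt_le_left (by positivity)]
      nlinarith
    rw [gaussianSmooth, ← integral_sub (hi _) (hφ.continuous.integrable_of_hasCompactSupport hφc)]
    refine (norm_integral_le_of_norm_le (f := fun z => φ (0 + √(1 + t ^ 2) • z) - φ z)
      (integrable_norm_stdGaussian.const_mul t) (ae_of_all _ fun z => ?_)).trans ?_
    · have := hφL.dist_le_mul (0 + √(1 + t ^ 2) • z) z
      rw [NNReal.coe_one, one_mul, Real.dist_eq, dist_eq_norm] at this
      refine this.trans ?_
      rw [show 0 + √(1 + t ^ 2) • z - z = (√(1 + t ^ 2) - 1) • z by rw [sub_smul]; simp,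
        norm_smul, Real.norm_of_nonneg (by linarith)]
      gcongr
      linarith
    · rw [integral_const_mul]
      gcongr
      exact integral_norm_stdGaussian_le
  rw [integral_map hW.aemeasurable hφ.continuous.aestronglyMeasurable]
  have e4 : (1 / 2 * e + 1 / (12 * t) * T) / lam ≤ 1 / lam * e + 1 / lam * T / (12 * t) := by
    have : 0 ≤ e / lam := by positivity
    have h1 : (1 / 2 * e + 1 / (12 * t) * T) / lam =
        1 / 2 * (e / lam) + 1 / lam * T / (12 * t) := by field_simp
    have h2 : 1 / lam * e = e / lam := by ring
    rw [h1, h2]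
    linarith
  rw [abs_le] at *
  constructor <;> linarith [e1.1, e1.2, e2.1, e2.2, e3.1, e3.2]

end Wasserstein

/-! ### Log-concave measures close to the Gaussian measure -/

section LogConcave

variable {k : ℕ} {μ : Measure (EuclideanSpace ℝ (Fin k))} {f : EuclideanSpace ℝ (Fin k) → ℝ}

lemma integral_eq_of_eq_withDensity (hfm : Measurable f) (hf0 : ∀ x, 0 ≤ f x)
    (hμ : μ = volume.withDensity fun x => ENNReal.ofReal (f x))
    (φ : EuclideanSpace ℝ (Fin k) → ℝ) : ∫ x, φ x ∂μ = ∫ x, φ x * f x := by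
  rw [hμ, integral_withDensity_eq_integral_toReal_smul (by fun_prop) (ae_of_all _ fun _ => by simp)]
  congr 1
  ext x
  rw [ENNReal.toReal_ofReal (hf0 x), smul_eq_mul, mul_comm]

lemma integral_comp_smul_add {r : ℝ} (hr : 0 < r) (c : EuclideanSpace ℝ (Fin k))
    (φ : EuclideanSpace ℝ (Fin k) → ℝ) :
    ∫ x, φ (r • x + c) = (r ^ k)⁻¹ * ∫ x, φ x := by
  rw [Measure.integral_comp_smul_of_nonneg volume (fun x => φ (x + c)) r (hR := hr.le),
    integral_add_right_eq_self φ c, finrank_euclideanSpace_fin, smul_eq_mul]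

lemma integrable_comp_smul_add {r : ℝ} (hr : 0 < r) (c : EuclideanSpace ℝ (Fin k))
    {φ : EuclideanSpace ℝ (Fin k) → ℝ} (hφ : Integrable φ) :
    Integrable fun x => φ (r • x + c) :=
  (hφ.comp_add_right c).comp_smul hr.ne'

variable [IsProbabilityMeasure μ]

lemma integrable_of_eq_withDensity (hfm : Measurable f) (hf0 : ∀ x, 0 ≤ f x)
    (hμ : μ = volume.withDensity fun x => ENNReal.ofReal (f x)) : Integrable f := by
  refine ⟨hfm.aestronglyMeasurable, ?_⟩
  rw [hasFiniteIntegral_iff_ofReal (ae_of_all _ hf0)]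
  have : μ Set.univ = ∫⁻ x, ENNReal.ofReal (f x) := by
    rw [hμ, withDensity_apply _ MeasurableSet.univ, Measure.restrict_univ]
  rw [← this]
  exact measure_lt_top _ _

/-- A log-concave density puts little mass where it is exponentially smaller than one of its values:
there it is much smaller than its dilation by a factor `1 / 2` towards the point of that value. -/
lemma IsLogConcaveFun.measureReal_lt_le (hf : IsLogConcaveFun f) (hfm : Measurable f)
    (hμ : μ = volume.withDensity fun x => ENNReal.ofReal (f x)) (hk : 0 < k)
    (x₀ : EuclideanSpace ℝ (Fin k)) :
    μ.real {x | f x < Real.exp (-(10 * k)) * f x₀} ≤ 1 / 50 := by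
  set S := {x | f x < Real.exp (-(10 * k)) * f x₀} with hS
  have hSm : MeasurableSet S := measurableSet_lt hfm measurable_const
  have hfi := integrable_of_eq_withDensity hfm hf.1 hμ
  have hone : ∫ x, f x = 1 := by
    have := integral_eq_of_eq_withDensity hfm hf.1 hμ (fun _ => 1)
    simpa using this.symm
  have hpt : ∀ x ∈ S, f x ≤ Real.exp (-(5 * k)) * f ((1 / 2 : ℝ) • x + (1 / 2 : ℝ) • x₀) := by
    intro x hx
    have h1 := hf.2 x x₀ (1 / 2) (1 / 2) (by norm_num) (by norm_num) (by norm_num)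
    rw [← Real.sqrt_eq_rpow, ← Real.sqrt_eq_rpow] at h1
    calc f x = √(f x) * √(f x) := (Real.mul_self_sqrt (hf.1 x)).symm
      _ ≤ √(f x) * √(Real.exp (-(10 * k)) * f x₀) := by
          gcongr
          exact le_of_lt hx
      _ = √(f x) * (Real.exp (-(5 * k)) * √(f x₀)) := by
          rw [Real.sqrt_mul (Real.exp_pos _).le, show -(10 * (k : ℝ)) = -(5 * k) + -(5 * k) by ring,
            Real.exp_add, Real.sqrt_mul_self (Real.exp_pos _).le]
      _ = Real.exp (-(5 * k)) * (√(f x) * √(f x₀)) := by ring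
      _ ≤ _ := by gcongr
  have hnum : Real.exp (-(5 * k)) * 2 ^ k ≤ 1 / 50 := by
    have he : Real.exp (-(5 * k)) * 2 ^ k = (2 * Real.exp (-5)) ^ k := by
      rw [mul_pow, ← Real.exp_nat_mul, mul_comm, mul_comm (k : ℝ), neg_mul]
    have h5 : 2 * Real.exp (-5) ≤ 1 / 50 := by
      have h1 : (100 : ℝ) ≤ Real.exp 5 := by
        have := Real.exp_one_gt_d9
        calc (100 : ℝ) ≤ 2.7 ^ 5 := by norm_num
          _ ≤ Real.exp 1 ^ 5 := by gcongr; linarith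
          _ = Real.exp 5 := by rw [← Real.exp_nat_mul]; norm_num
      rw [Real.exp_neg, ← div_eq_mul_inv, div_le_div_iff₀ (Real.exp_pos _) (by norm_num)]
      linarith
    rw [he]
    refine (pow_le_pow_of_le_one (by positivity) (h5.trans (by norm_num)) hk).trans ?_
    rwa [pow_one]
  calc μ.real S = ∫ x, S.indicator 1 x * f x := by
        rw [← integral_eq_of_eq_withDensity hfm hf.1 hμ, integral_indicator_one hSm]
    _ ≤ ∫ x, Real.exp (-(5 * k)) * f ((1 / 2 : ℝ) • x + (1 / 2 : ℝ) • x₀) := by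
        refine integral_mono_of_nonneg (ae_of_all _ fun x => ?_)
          ((integrable_comp_smul_add (by norm_num) _ hfi).const_mul _) (ae_of_all _ fun x => ?_)
        · exact mul_nonneg (Set.indicator_nonneg (fun _ _ => zero_le_one) _) (hf.1 x)
        · by_cases hx : x ∈ S
          · simpa [hx] using hpt x hx
          · simp only [Set.indicator_of_notMem hx, zero_mul]
            exact mul_nonneg (Real.exp_pos _).le (hf.1 _)
    _ = Real.exp (-(5 * k)) * 2 ^ k := by
        rw [integral_const_mul, integral_comp_smul_add (by norm_num), hone]
        simp
    _ ≤ _ := hnum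

/-- If a log-concave measure is close to the standard Gaussian measure in the Wasserstein distance,
then its density near the origin is at least `exp (-10 k)` times any of its values. Otherwise a
half-space at distance at most `1 / 10` from the origin would carry almost all the mass, by
`IsLogConcaveFun.measureReal_lt_le`. -/
lemma IsLogConcaveFun.exp_mul_le (hf : IsLogConcaveFun f) (hfm : Measurable f)
    (hμ : μ = volume.withDensity fun x => ENNReal.ofReal (f x)) (hk : 0 < k)
    (hμi : Integrable (fun x => ‖x‖) μ)
    (hd : ∀ ψ : EuclideanSpace ℝ (Fin k) → ℝ, LipschitzWith 1 ψ →
      |∫ x, ψ x ∂μ - ∫ x, ψ x ∂stdGaussian (EuclideanSpace ℝ (Fin k))| ≤ 1 / 20)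
    (x₀ : EuclideanSpace ℝ (Fin k)) {y : EuclideanSpace ℝ (Fin k)} (hy : ‖y‖ ≤ 1 / 10) :
    Real.exp (-(10 * k)) * f x₀ ≤ f y := by
  by_contra! hlt
  set m := Real.exp (-(10 * k)) * f x₀ with hm
  have hm0 : 0 ≤ m := mul_nonneg (Real.exp_pos _).le (hf.1 _)
  set K := {x | m ≤ f x} with hK
  have hKc : Convex ℝ K := by
    refine convex_iff_forall_pos.2 fun x hx z hz a b ha hb hab => ?_
    refine le_trans ?_ (hf.2 x z a b ha hb hab)
    calc m = m ^ a * m ^ b := by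
          rw [← Real.rpow_add' hm0 (by rw [hab]; norm_num), hab, Real.rpow_one]
      _ ≤ _ := mul_le_mul (Real.rpow_le_rpow hm0 hx ha.le) (Real.rpow_le_rpow hm0 hz hb.le)
        (Real.rpow_nonneg hm0 _) (Real.rpow_nonneg (hf.1 _) _)
  have hyK : y ∉ interior K := fun h => absurd (interior_subset h) (not_le.2 hlt)
  have hmass : μ.real (interior K)ᶜ ≤ 1 / 50 := by
    have hsub : (interior K)ᶜ ⊆ {x | f x < m} ∪ frontier K := by
      intro x hx
      by_cases hxK : x ∈ K
      · exact Or.inr ⟨subset_closure hxK, hx⟩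
      · exact Or.inl (show f x < m from lt_of_not_ge hxK)
    have hfr : μ (frontier K) = 0 := by
      have hac : μ ≪ volume := by rw [hμ]; exact withDensity_absolutelyContinuous _ _
      exact hac (hKc.addHaar_frontier volume)
    calc μ.real (interior K)ᶜ ≤ μ.real {x | f x < m} + μ.real (frontier K) :=
          (measureReal_mono hsub).trans (measureReal_union_le _ _)
      _ ≤ 1 / 50 := by
          rw [measureReal_def μ (frontier K), hfr]
          simpa using hf.measureReal_lt_le hfm hμ hk x₀
  have hne : (interior K).Nonempty := by
    by_contra h
    rw [Set.not_nonempty_iff_eq_empty] at h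
    rw [h, Set.compl_empty, probReal_univ] at hmass
    norm_num at hmass
  obtain ⟨L, hL⟩ := geometric_hahn_banach_open_point hKc.interior isOpen_interior hyK
  obtain ⟨z, hz⟩ := hne
  set v₀ := (InnerProductSpace.toDual ℝ (EuclideanSpace ℝ (Fin k))).symm L with hv₀
  have hv₀L : ∀ x, ⟪v₀, x⟫ = L x := fun x => InnerProductSpace.toDual_symm_apply
  have hv₀0 : 0 < ‖v₀‖ := by
    refine norm_pos_iff.2 fun h => ?_
    have h1 := hL z hz
    rw [← hv₀L, ← hv₀L, h] at h1
    simp at h1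
  set v := ‖v₀‖⁻¹ • v₀ with hv
  have hv1 : ‖v‖ = 1 := by rw [hv, norm_smul, norm_inv, norm_norm, inv_mul_cancel₀ hv₀0.ne']
  have hvK : ∀ x ∈ interior K, ⟪v, x⟫ ≤ 1 / 10 := by
    intro x hx
    have h1 : ⟪v, x⟫ ≤ ⟪v, y⟫ := by
      rw [hv, real_inner_smul_left, real_inner_smul_left, hv₀L, hv₀L]
      exact mul_le_mul_of_nonneg_left (hL x hx).le (by positivity)
    have h2 := real_inner_le_norm v y
    rw [hv1, one_mul] at h2
    linarith
  have hvL : LipschitzWith 1 (fun x : EuclideanSpace ℝ (Fin k) => ⟪v, x⟫) := by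
    refine LipschitzWith.of_dist_le_mul fun x z => ?_
    rw [Real.dist_eq, ← inner_sub_right, dist_eq_norm, NNReal.coe_one, ← hv1]
    exact abs_real_inner_le_norm v _
  have hψL : ∀ a : ℝ, LipschitzWith 1 (fun x : EuclideanSpace ℝ (Fin k) => max (⟪v, x⟫ - a) 0) := by
    intro a
    have : LipschitzWith 1 (fun x : EuclideanSpace ℝ (Fin k) => ⟪v, x⟫ - a) :=
      LipschitzWith.of_dist_le_mul fun x z => by simpa using hvL.dist_le_mul x z
    exact this.max_const 0
  have hvi : Integrable (fun x => ⟪v, x⟫) μ := by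
    refine hμi.mono (by fun_prop) (ae_of_all _ fun x => ?_)
    rw [norm_norm, Real.norm_eq_abs]
    have := abs_real_inner_le_norm v x
    rwa [hv1, one_mul] at this
  have hψi : ∀ a : ℝ, Integrable (fun x => max (⟪v, x⟫ - a) 0) μ := fun a =>
    (hvi.sub (integrable_const a)).pos_part
  set γ := stdGaussian (EuclideanSpace ℝ (Fin k)) with hγ
  have hvγ := integrable_inner_stdGaussian v
  have hψγ : ∀ a : ℝ, Integrable (fun x => max (⟪v, x⟫ - a) 0) γ := fun a =>
    (hvγ.sub (integrable_const a)).pos_part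
  -- Under `μ`, the coordinate `⟪v, x⟫` rarely exceeds `1 / 10`; truncate at `2`.
  have h1 : ∫ x, max (⟪v, x⟫ - 1 / 10) 0 ∂μ ≤ 2 * (1 / 50) + ∫ x, max (⟪v, x⟫ - 2) 0 ∂μ := by
    have hmeas : MeasurableSet (interior K)ᶜ := isOpen_interior.measurableSet.compl
    have hind : Integrable ((interior K)ᶜ.indicator (1 : EuclideanSpace ℝ (Fin k) → ℝ)) μ :=
      (integrable_indicator_iff hmeas).2 (integrable_const (1 : ℝ)).integrableOn
    calc ∫ x, max (⟪v, x⟫ - 1 / 10) 0 ∂μ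
        ≤ ∫ x, (2 * (interior K)ᶜ.indicator 1 x + max (⟪v, x⟫ - 2) 0) ∂μ := by
          refine integral_mono (hψi _) ((hind.const_mul 2).add (hψi 2)) fun x => ?_
          by_cases hx : x ∈ interior K
          · have := hvK x hx
            rw [Set.indicator_of_notMem (by simpa using hx), mul_zero, zero_add,
              max_eq_right (by linarith)]
            exact le_max_right _ _
          · simp only [Set.indicator_of_mem (Set.mem_compl hx), Pi.one_apply]
            refine max_le ?_ ?_
            · linarith [le_max_left (⟪v, x⟫ - 2) 0]
            · linarith [le_max_right (⟪v, x⟫ - 2) 0]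
      _ = 2 * μ.real (interior K)ᶜ + ∫ x, max (⟪v, x⟫ - 2) 0 ∂μ := by
          rw [integral_add (hind.const_mul 2) (hψi 2), integral_const_mul,
            integral_indicator_one hmeas]
      _ ≤ _ := by gcongr
  have h2 : 1 / 2 * √(2 / Real.pi) - 1 / 10 ≤ ∫ x, max (⟪v, x⟫ - 1 / 10) 0 ∂γ := by
    have hlow : ∫ x, (1 / 2 * |⟪v, x⟫| + 1 / 2 * ⟪v, x⟫ - 1 / 10) ∂γ =
        1 / 2 * √(2 / Real.pi) - 1 / 10 := by
      have i1 : Integrable (fun x => 1 / 2 * |⟪v, x⟫| + 1 / 2 * ⟪v, x⟫) γ :=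
        (hvγ.abs.const_mul _).add (hvγ.const_mul _)
      have e1 : ∫ x, ⟪v, x⟫ ∂γ = 0 := integral_strongDual_stdGaussian (innerSL ℝ v)
      rw [integral_sub i1 (integrable_const _), integral_add (hvγ.abs.const_mul _)
        (hvγ.const_mul _), integral_const_mul, integral_const_mul, e1,
        integral_abs_inner_stdGaussian, hv1]
      simp
    rw [← hlow]
    refine integral_mono (((hvγ.abs.const_mul _).add (hvγ.const_mul _)).sub (integrable_const _))
      (hψγ _) fun x => ?_
    simp only
    rcases le_total 0 ⟪v, x⟫ with h0 | h0
    · rw [abs_of_nonneg h0]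
      exact le_max_of_le_left (by linarith)
    · rw [abs_of_nonpos h0]
      exact le_max_of_le_right (by linarith)
  have h3 : ∫ x, max (⟪v, x⟫ - 2) 0 ∂γ ≤ 1 / 8 := by
    have hsq : ∫ x, 1 / 8 * (⟪v, x⟫ * ⟪v, x⟫) ∂γ = 1 / 8 := by
      rw [integral_const_mul, integral_inner_mul_inner_stdGaussian, real_inner_self_eq_norm_sq, hv1]
      norm_num
    rw [← hsq]
    refine integral_mono (hψγ 2) ((integrable_inner_mul_inner_stdGaussian v v).const_mul _)
      fun x => max_le ?_ ?_
    · nlinarith [sq_nonneg (⟪v, x⟫ - 4)]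
    · nlinarith [sq_nonneg ⟪v, x⟫]
  have h4 := abs_le.1 (hd _ (hψL (1 / 10)))
  have h5 := abs_le.1 (hd _ (hψL 2))
  have h6 : (0.79 : ℝ) ≤ √(2 / Real.pi) := by
    apply Real.le_sqrt_of_sq_le
    rw [le_div_iff₀ Real.pi_pos]
    nlinarith [Real.pi_lt_d2]
  -- `1 / 2 * 0.79 - 1 / 10 - 1 / 20 = 0.245` exceeds `2 / 50 + 1 / 8 + 1 / 20 = 0.215`.
  linarith [h4.1, h5.2]

/-- A measure whose density has the lower bound of `IsLogConcaveFun.exp_mul_le` nearly dominates its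
images under contractions, even after a small translation. Two probability measures, one of which
nearly dominates the other, are close in total variation. -/
lemma IsLogConcaveFun.abs_integral_comp_smul_add_sub_le (hf : IsLogConcaveFun f)
    (hfm : Measurable f) (hμ : μ = volume.withDensity fun x => ENNReal.ofReal (f x))
    (hlow : ∀ x y, ‖y‖ ≤ 1 / 10 → Real.exp (-(10 * k)) * f x ≤ f y)
    {φ : EuclideanSpace ℝ (Fin k) → ℝ} (hφ : Measurable φ) (hφ01 : ∀ x, φ x ∈ Set.Icc 0 1)
    {τ : ℝ} (hτ0 : 0 < τ) (hτ1 : τ < 1) {y : EuclideanSpace ℝ (Fin k)} (hy : ‖y‖ ≤ τ / 10) :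
    |∫ x, φ ((1 - τ) • x + y) ∂μ - ∫ x, φ x ∂μ| ≤ 11 * k * τ := by
  have hfi := integrable_of_eq_withDensity hfm hf.1 hμ
  have hτ1' : 0 < 1 - τ := by linarith
  have hpt : ∀ x, f x ≤ Real.exp (10 * k * τ) * f ((1 - τ) • x + y) := by
    intro x
    have hw : ‖τ⁻¹ • y‖ ≤ 1 / 10 := by
      rw [norm_smul, norm_inv, Real.norm_of_nonneg hτ0.le, inv_mul_le_iff₀ hτ0]
      linarith
    have h1 := hf.2 x (τ⁻¹ • y) (1 - τ) τ hτ1' hτ0 (by ring)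
    rw [smul_inv_smul₀ hτ0.ne'] at h1
    have h2 : Real.exp (-(10 * k * τ)) * f x ≤ f x ^ (1 - τ) * f (τ⁻¹ • y) ^ τ := by
      calc Real.exp (-(10 * k * τ)) * f x
          = f x ^ (1 - τ) * (Real.exp (-(10 * k)) * f x) ^ τ := by
            rw [Real.mul_rpow (Real.exp_pos _).le (hf.1 x), ← Real.exp_mul, mul_left_comm,
              ← Real.rpow_add' (hf.1 x) (by simp)]
            simp
        _ ≤ _ := by
            refine mul_le_mul_of_nonneg_left (Real.rpow_le_rpow ?_ (hlow x _ hw) hτ0.le)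
              (Real.rpow_nonneg (hf.1 x) _)
            exact mul_nonneg (Real.exp_pos _).le (hf.1 x)
    rw [Real.exp_neg, inv_mul_le_iff₀ (Real.exp_pos _)] at h2
    exact h2.trans (by gcongr)
  set c := (1 - τ) ^ k * Real.exp (-(10 * k * τ)) with hc
  have hc0 : 0 < c := by positivity
  have hc1 : 1 - c ≤ 11 * k * τ := by
    have h1 : 1 - k * τ ≤ (1 - τ) ^ k := by
      have := one_add_mul_le_pow (a := -τ) (by linarith) k
      rw [← sub_eq_add_neg] at this
      linarith
    have h2 := Real.add_one_le_exp (-(10 * k * τ))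
    have h3 : (1 - τ) ^ k ≤ 1 := pow_le_one₀ hτ1'.le (by linarith)
    have h4 : 0 ≤ (1 - τ) ^ k := by positivity
    have h5 : 0 ≤ 10 * k * τ := by positivity
    rw [hc]
    nlinarith [mul_le_mul_of_nonneg_left h2 h4, mul_nonneg h5 (sub_nonneg.2 h3)]
  have hφi : ∀ {φ : EuclideanSpace ℝ (Fin k) → ℝ}, Measurable φ → (∀ x, φ x ∈ Set.Icc 0 1) →
      Integrable fun x => φ x * f x := by
    intro φ hφ hφ01
    refine hfi.bdd_mul (c := 1) hφ.aestronglyMeasurable (ae_of_all _ fun x => ?_)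
    rw [Real.norm_of_nonneg (hφ01 x).1]
    exact (hφ01 x).2
  have hle1 : ∀ {φ : EuclideanSpace ℝ (Fin k) → ℝ}, Measurable φ → (∀ x, φ x ∈ Set.Icc 0 1) →
      ∫ x, φ x ∂μ ≤ 1 := by
    intro φ hφ hφ01
    refine (integral_mono_of_nonneg (ae_of_all _ fun x => (hφ01 x).1) (integrable_const (1 : ℝ))
      (ae_of_all _ fun x => (hφ01 x).2)).trans ?_
    simp
  have hmain : ∀ {φ : EuclideanSpace ℝ (Fin k) → ℝ}, Measurable φ → (∀ x, φ x ∈ Set.Icc 0 1) →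
      ∫ x, φ ((1 - τ) • x + y) ∂μ - ∫ x, φ x ∂μ ≤ 1 - c := by
    intro φ hφ hφ01
    have hdom : c * ∫ x, φ ((1 - τ) • x + y) ∂μ ≤ ∫ x, φ x ∂μ := by
      rw [integral_eq_of_eq_withDensity hfm hf.1 hμ, integral_eq_of_eq_withDensity hfm hf.1 hμ]
      have h1 : ∫ x, φ ((1 - τ) • x + y) * f x ≤ ∫ x, Real.exp (10 * k * τ) *
          (φ ((1 - τ) • x + y) * f ((1 - τ) • x + y)) := by
        refine integral_mono (hφi (hφ.comp (by fun_prop)) fun x => hφ01 _)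
          ((integrable_comp_smul_add hτ1' y (hφi hφ hφ01)).const_mul _) fun x => ?_
        simp only
        rw [mul_left_comm]
        exact mul_le_mul_of_nonneg_left (hpt x) (hφ01 _).1
      rw [integral_const_mul, integral_comp_smul_add hτ1' y (fun x => φ x * f x)] at h1
      refine (mul_le_mul_of_nonneg_left h1 hc0.le).trans_eq ?_
      rw [hc, Real.exp_neg]
      field_simp
    have h1 : ∫ x, φ ((1 - τ) • x + y) ∂μ ≤ 1 :=
      hle1 (φ := fun x => φ ((1 - τ) • x + y)) (hφ.comp (by fun_prop)) fun x => hφ01 _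
    have hcle : c ≤ 1 := by
      rw [hc]
      refine mul_le_one₀ (pow_le_one₀ hτ1'.le (by linarith)) (Real.exp_pos _).le ?_
      rw [Real.exp_le_one_iff]
      have : 0 ≤ 10 * k * τ := by positivity
      linarith
    nlinarith [mul_nonneg (sub_nonneg.2 hcle) (sub_nonneg.2 h1)]
  have hA := hmain hφ hφ01
  -- Exchanging `φ` with `1 - φ` gives the opposite inequality.
  have hB := hmain (φ := fun x => 1 - φ x) (measurable_const.sub hφ)
    fun x => ⟨by linarith [(hφ01 x).2], by linarith [(hφ01 x).1]⟩
  have hint : ∀ {φ : EuclideanSpace ℝ (Fin k) → ℝ}, Measurable φ → (∀ x, φ x ∈ Set.Icc 0 1) →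
      Integrable φ μ := fun hφ h => Integrable.of_bound hφ.aestronglyMeasurable 1
        (ae_of_all _ fun x => by rw [Real.norm_of_nonneg (h x).1]; exact (h x).2)
  rw [integral_sub (integrable_const _) (hint (φ := fun x => φ ((1 - τ) • x + y))
    (hφ.comp (by fun_prop)) fun x => hφ01 _),
    integral_sub (integrable_const _) (hint hφ hφ01)] at hB
  rw [abs_le]
  constructor <;> linarith

/-- Translations move a measure with such a density by at most a multiple of `k` times the length of
the translation, in total variation. -/
lemma IsLogConcaveFun.abs_integral_comp_add_sub_le (hf : IsLogConcaveFun f)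
    (hfm : Measurable f) (hμ : μ = volume.withDensity fun x => ENNReal.ofReal (f x)) (hk : 0 < k)
    (hlow : ∀ x y, ‖y‖ ≤ 1 / 10 → Real.exp (-(10 * k)) * f x ≤ f y)
    {φ : EuclideanSpace ℝ (Fin k) → ℝ} (hφ : Measurable φ) (hφ01 : ∀ x, φ x ∈ Set.Icc 0 1)
    (y : EuclideanSpace ℝ (Fin k)) :
    |∫ x, φ (x + y) ∂μ - ∫ x, φ x ∂μ| ≤ 220 * k * ‖y‖ := by
  have hk1 : (1 : ℝ) ≤ k := by exact_mod_cast hk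
  rcases eq_or_ne y 0 with rfl | hy0
  · simp
  have hyp : 0 < ‖y‖ := norm_pos_iff.2 hy0
  -- For small `y`, both `φ` and its translate are compared with their contractions by `1 - 10 ‖y‖`.
  rcases lt_or_ge (10 * ‖y‖) 1 with h | h
  · have h1 := hf.abs_integral_comp_smul_add_sub_le hfm hμ hlow hφ hφ01 (τ := 10 * ‖y‖)
      (by positivity) h (y := y) (by linarith)
    have h2 := hf.abs_integral_comp_smul_add_sub_le hfm hμ hlow (φ := fun x => φ (x + y))
      (hφ.comp (by fun_prop)) (fun x => hφ01 _) (τ := 10 * ‖y‖)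
      (by positivity) h (y := 0) (by simp)
    simp only [add_zero] at h2
    rw [abs_le] at *
    constructor <;> linarith [h1.1, h1.2, h2.1, h2.2]
  · have hb : ∀ {φ : EuclideanSpace ℝ (Fin k) → ℝ}, (∀ x, φ x ∈ Set.Icc 0 1) →
        0 ≤ ∫ x, φ x ∂μ ∧ ∫ x, φ x ∂μ ≤ 1 := fun h =>
      ⟨integral_nonneg fun x => (h x).1, (integral_mono_of_nonneg (ae_of_all _ fun x => (h x).1)
        (integrable_const (1 : ℝ)) (ae_of_all _ fun x => (h x).2)).trans (by simp)⟩
    have h1 := hb hφ01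
    have h2 := hb (φ := fun x => φ (x + y)) fun x => hφ01 _
    have h3 : 1 ≤ 220 * k * ‖y‖ := by nlinarith
    rw [abs_le]
    constructor <;> linarith [h1.1, h1.2, h2.1, h2.2]

/-- Gaussian smoothing at scale `t` moves such a measure by at most a multiple of `k ^ (3 / 2) * t`
in total variation. -/
lemma IsLogConcaveFun.abs_integral_gaussianSmooth_sub_le (hf : IsLogConcaveFun f)
    (hfm : Measurable f) (hμ : μ = volume.withDensity fun x => ENNReal.ofReal (f x)) (hk : 0 < k)
    (hlow : ∀ x y, ‖y‖ ≤ 1 / 10 → Real.exp (-(10 * k)) * f x ≤ f y)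
    {φ : EuclideanSpace ℝ (Fin k) → ℝ} (hφ : Measurable φ) (hφ01 : ∀ x, φ x ∈ Set.Icc 0 1)
    {t : ℝ} (ht : 0 ≤ t) :
    |∫ x, gaussianSmooth t φ x ∂μ - ∫ x, φ x ∂μ| ≤ 220 * k * (t * √k) := by
  set γ := stdGaussian (EuclideanSpace ℝ (Fin k)) with hγ
  have hint : Integrable (Function.uncurry fun x z => φ (x + t • z)) (μ.prod γ) := by
    refine Integrable.of_bound (Measurable.aestronglyMeasurable ?_) 1 (ae_of_all _ fun p => ?_)
    · exact hφ.comp (by fun_prop)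
    · rw [Function.uncurry, Real.norm_of_nonneg (hφ01 _).1]
      exact (hφ01 _).2
  have e1 : ∫ x, gaussianSmooth t φ x ∂μ = ∫ z, ∫ x, φ (x + t • z) ∂μ ∂γ :=
    integral_integral_swap hint
  have e2 : ∫ x, gaussianSmooth t φ x ∂μ - ∫ x, φ x ∂μ =
      ∫ z, (∫ x, φ (x + t • z) ∂μ - ∫ x, φ x ∂μ) ∂γ := by
    have hi : Integrable (fun z => ∫ x, φ (x + t • z) ∂μ) γ := hint.integral_prod_right
    rw [e1, integral_sub hi (integrable_const _)]
    simp
  rw [e2]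
  refine (norm_integral_le_of_norm_le
    (f := fun z => ∫ x, φ (x + t • z) ∂μ - ∫ x, φ x ∂μ)
    (integrable_norm_stdGaussian.const_mul (220 * k * t)) (ae_of_all _ fun z => ?_)).trans ?_
  · refine (hf.abs_integral_comp_add_sub_le hfm hμ hk hlow hφ hφ01 (t • z)).trans_eq ?_
    rw [norm_smul, Real.norm_of_nonneg ht]
    ring
  · rw [integral_const_mul, ← mul_assoc]
    gcongr
    exact integral_norm_stdGaussian_le

end LogConcave

/-! ### The two distances -/

section Distances

lemma lintegral_enorm_pow_eq_ofReal {X Ω : Type*} [MeasurableSpace Ω] {P : Measure Ω}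
    [NormedAddCommGroup X] {g : Ω → X} {n : ℕ} (hg : Integrable (fun ω => ‖g ω‖ ^ n) P) :
    ∫⁻ ω, ‖g ω‖ₑ ^ n ∂P = ENNReal.ofReal (∫ ω, ‖g ω‖ ^ n ∂P) := by
  rw [ofReal_integral_eq_lintegral_ofReal hg (ae_of_all _ fun _ => by positivity)]
  simp_rw [ENNReal.ofReal_pow (norm_nonneg _), ofReal_norm]

variable {k : ℕ} {Ω : Type*} [MeasurableSpace Ω] {P : Measure Ω} [IsProbabilityMeasure P]
    {W W' : Ω → EuclideanSpace ℝ (Fin k)} {lam : ℝ} {E : Fin k → Fin k → Ω → ℝ}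

/-- Changing the variance of a Gaussian average from `1` to `1 + t ^ 2`. -/
lemma BddC1.abs_gaussianSmooth_sqrt_sub_le {φ : EuclideanSpace ℝ (Fin k) → ℝ} (hφ : BddC1 φ)
    (hb : ∀ x, |φ x| ≤ 1) {t : ℝ} (ht : 0 ≤ t) :
    |_root_.gaussianSmooth √(1 + t ^ 2) φ 0 - ∫ x, φ x ∂stdGaussian (EuclideanSpace ℝ (Fin k))| ≤
      t * √k := by
  have e1 : _root_.gaussianSmooth √(1 + t ^ 2) φ 0 =
      ∫ z, _root_.gaussianSmooth 1 φ (0 + t • z) ∂stdGaussian (EuclideanSpace ℝ (Fin k)) := by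
    have := gaussianSmooth_gaussianSmooth hφ.continuous hb t 1 0
    rw [one_pow, add_comm] at this
    exact this.symm
  have e2 : ∫ x, φ x ∂stdGaussian (EuclideanSpace ℝ (Fin k)) = _root_.gaussianSmooth 1 φ 0 := by
    simp [_root_.gaussianSmooth]
  have hi : Integrable (fun z => _root_.gaussianSmooth 1 φ (0 + t • z))
      (stdGaussian (EuclideanSpace ℝ (Fin k))) := by
    refine Integrable.of_bound
      ((hφ.gaussianSmooth 1).continuous.comp (by fun_prop)).aestronglyMeasurable 1
      (ae_of_all _ fun z => ?_)
    exact BddC1.abs_gaussianSmooth_le hb 1 _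
  have e3 : _root_.gaussianSmooth √(1 + t ^ 2) φ 0 -
      ∫ x, φ x ∂stdGaussian (EuclideanSpace ℝ (Fin k)) =
      ∫ z, (_root_.gaussianSmooth 1 φ (0 + t • z) - _root_.gaussianSmooth 1 φ 0)
        ∂stdGaussian (EuclideanSpace ℝ (Fin k)) := by
    rw [integral_sub hi (integrable_const _), e1, e2]
    simp
  rw [e3]
  refine (norm_integral_le_of_norm_le
    (f := fun z => _root_.gaussianSmooth 1 φ (0 + t • z) - _root_.gaussianSmooth 1 φ 0)
    (integrable_norm_stdGaussian.const_mul t) (ae_of_all _ fun z => ?_)).trans ?_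
  · refine (hφ.abs_gaussianSmooth_sub_le one_pos hb _ _).trans ?_
    rw [zero_add, sub_zero, norm_smul, Real.norm_of_nonneg ht, mul_one, div_one]
    exact mul_le_of_le_one_left (by positivity) sqrt_two_div_pi_le_one
  · rw [integral_const_mul]
    gcongr
    exact integral_norm_stdGaussian_le

/-- The total variation bound in terms of a scale `s` with `k A + k ^ 2 B ≤ s ^ 3`, where `A` and
`B` are the error and third-moment terms. Both measures are smoothed at the scale
`t = s / k ^ (3 / 2)`, which balances the cost of smoothing the log-concave measure against
the smoothed distance. -/
lemma IsSteinPair.abs_measureReal_sub_le (h : IsSteinPair P W W' lam E) (hk : 0 < k)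
    (hT : Integrable (fun ω => ‖W' ω - W ω‖ ^ 3) P) (hlc : IsLogConcaveMeasure (P.map W)) {s : ℝ}
    (hs : 0 < s)
    (hAB : k * ((∫ ω, √(∑ i, ∑ j, E i j ω ^ 2) ∂P) / lam) +
      k ^ 2 * ((∫ ω, ‖W' ω - W ω‖ ^ 3 ∂P) / lam) ≤ s ^ 3)
    {S : Set (EuclideanSpace ℝ (Fin k))} (hS : MeasurableSet S) :
    |(P.map W).real S - (stdGaussian (EuclideanSpace ℝ (Fin k))).real S| ≤ 225 * s := by
  have hlam := h.lam_pos
  have hW := h.measurable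
  have : IsProbabilityMeasure (P.map W) := Measure.isProbabilityMeasure_map hW.aemeasurable
  -- The difference never exceeds `1`, so only small `s` matter.
  rcases le_or_gt (1 / 10) s with hs1 | hs1
  · have h1 := measureReal_nonneg (μ := P.map W) (s := S)
    have h2 := measureReal_nonneg (μ := stdGaussian (EuclideanSpace ℝ (Fin k))) (s := S)
    have h3 := measureReal_le_one (μ := P.map W) (s := S)
    have h4 := measureReal_le_one (μ := stdGaussian (EuclideanSpace ℝ (Fin k))) (s := S)
    rw [abs_le]
    constructor <;> linarith
  obtain ⟨f, hfm, hf, hμ⟩ := hlc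
  have hk1 : (1 : ℝ) ≤ k := by exact_mod_cast hk
  set A := (∫ ω, √(∑ i, ∑ j, E i j ω ^ 2) ∂P) / lam with hA
  set B := (∫ ω, ‖W' ω - W ω‖ ^ 3 ∂P) / lam with hB
  have hA0 : 0 ≤ A := div_nonneg (integral_nonneg fun _ => by positivity) hlam.le
  have hB0 : 0 ≤ B := div_nonneg (integral_nonneg fun _ => by positivity) hlam.le
  set q := √(k : ℝ) with hq
  have hqk : q * q = k := Real.mul_self_sqrt (by positivity)
  have hq1 : 1 ≤ q := Real.one_le_sqrt.2 hk1
  have hkA : k * A ≤ s ^ 3 := by nlinarith [mul_nonneg (sq_nonneg (k : ℝ)) hB0]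
  have hkB : k ^ 2 * B ≤ s ^ 3 := by nlinarith [mul_nonneg (zero_le_one.trans hk1) hA0]
  have hs3 : s ^ 3 ≤ 1 / 1000 := by
    calc s ^ 3 ≤ (1 / 10) ^ 3 := by gcongr
      _ = _ := by norm_num
  have hqB : q * B ≤ s ^ 3 := by
    refine le_trans ?_ hkB
    gcongr
    nlinarith
  -- The Wasserstein bound is below the threshold of `IsLogConcaveFun.exp_mul_le`.
  have hd : ∀ ψ : EuclideanSpace ℝ (Fin k) → ℝ, LipschitzWith 1 ψ →
      |∫ x, ψ x ∂(P.map W) - ∫ x, ψ x ∂stdGaussian (EuclideanSpace ℝ (Fin k))| ≤ 1 / 20 := by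
    intro ψ hψ
    refine (h.abs_integral_sub_le hk hT hψ).trans ?_
    rw [one_div_mul_eq_div, one_div_mul_eq_div, ← hA, ← hB, ← hq]
    have h1 : √(2 / 3 * q * B) ≤ 1 / 30 := by
      refine Real.sqrt_le_iff.2 ⟨by norm_num, ?_⟩
      linarith
    have h2 : A ≤ k * A := le_mul_of_one_le_left hA0 hk1
    linarith
  have hμi : Integrable (fun x => ‖x‖) (P.map W) :=
    (integrable_map_measure (by fun_prop) hW.aemeasurable).2 h.integrable.norm
  have hlow := fun x₀ y (hy : ‖y‖ ≤ 1 / 10) => hf.exp_mul_le hfm hμ hk hμi hd x₀ hy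
  refine abs_measureReal_sub_le_of_forall_contDiff (fun φ hφ hφc hφ01 => ?_) hS
  have hb : ∀ x, |φ x| ≤ 1 := fun x => by
    rw [abs_of_nonneg (hφ01 x).1]
    exact (hφ01 x).2
  set t := s / (k * q) with ht
  have hkq : 0 < k * q := by positivity
  have ht0 : 0 < t := by positivity
  have htq : k * (t * q) = s := by
    rw [ht]
    field_simp
  have h1 := hf.abs_integral_gaussianSmooth_sub_le hfm hμ hk hlow hφ.continuous.measurable hφ01
    ht0.le
  have h2 := h.abs_integral_gaussianSmooth_sub_le_of_bounded hT
    (.of_hasCompactSupport hφ hφc) hb ht0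
  have h3 := (BddC1.of_hasCompactSupport hφ hφc).abs_gaussianSmooth_sqrt_sub_le hb ht0.le
  rw [← integral_map hW.aemeasurable
    ((BddC1.of_hasCompactSupport hφ hφc).gaussianSmooth t).continuous.aestronglyMeasurable,
    add_div, mul_div_assoc, mul_div_assoc, ← hA, ← hB] at h2
  have h4 : t * q ≤ s := by
    rw [← htq]
    exact le_mul_of_one_le_left (by positivity) hk1
  have hqk' : q ≤ k := by nlinarith
  have h5 : 2 / √t * A ≤ 2 * s := by
    have hAt : A / s ≤ √t := by
      refine Real.le_sqrt_of_sq_le ?_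
      rw [ht, div_pow, div_le_div_iff₀ (by positivity) hkq]
      calc A ^ 2 * (k * q) ≤ A ^ 2 * (k * k) := by gcongr
        _ = (k * A) ^ 2 := by ring
        _ ≤ (s ^ 3) ^ 2 := by gcongr
        _ = s ^ 3 * s ^ 3 := by ring
        _ ≤ 1 * s ^ 3 := by
            gcongr
            linarith
        _ = s * s ^ 2 := by ring
    have hst := Real.sqrt_pos.2 ht0
    rw [div_le_iff₀ hs] at hAt
    rw [div_mul_eq_mul_div, div_le_iff₀ hst]
    linarith
  have h6 : 1 / t * B ≤ s := by
    rw [one_div_mul_eq_div, div_le_iff₀ ht0, ht, mul_div_assoc', le_div_iff₀ hkq]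
    calc B * (k * q) ≤ B * (k * k) := by gcongr
      _ = k ^ 2 * B := by ring
      _ ≤ s ^ 3 := hkB
      _ = s * (s * s) := by ring
      _ ≤ 1 * (s * s) := by
          gcongr
          linarith
      _ = s * s := one_mul _
  rw [mul_assoc, htq] at h1
  rw [abs_le] at h1 h2 h3 ⊢
  constructor <;> linarith [h1.1, h1.2, h2.1, h2.2, h3.1, h3.2]

lemma eq_of_subsingleton {X : Type*} [MeasurableSpace X] [Subsingleton X] (μ ν : Measure X)
    [IsProbabilityMeasure μ] [IsProbabilityMeasure ν] : μ = ν := by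
  ext S -
  rcases S.eq_empty_or_nonempty with rfl | hS
  · simp
  · rw [hS.eq_univ, measure_univ, measure_univ]

lemma wassersteinDist_self {X : Type*} [PseudoMetricSpace X] [MeasurableSpace X] (μ : Measure X) :
    wassersteinDist μ μ = 0 := by
  simp [wassersteinDist]

lemma totalVariationDist_self {X : Type*} [MeasurableSpace X] (μ : Measure X) :
    totalVariationDist μ μ = 0 := by
  simp [totalVariationDist]

/-- The extended real form of `IsSteinPair.abs_integral_sub_le`. -/
lemma IsSteinPair.wassersteinDist_le (h : IsSteinPair P W W' lam E) (hk : 0 < k)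
    (hT : Integrable (fun ω => ‖W' ω - W ω‖ ^ 3) P) :
    wassersteinDist (P.map W) (stdGaussian (EuclideanSpace ℝ (Fin k))) ≤
      ENNReal.ofReal (1 / lam) * ∫⁻ ω, ENNReal.ofReal √(∑ i, ∑ j, E i j ω ^ 2) ∂P
        + (k : ℝ≥0∞) ^ (1 / 4 : ℝ)
          * (ENNReal.ofReal (2 / (3 * lam)) * ∫⁻ ω, ‖W' ω - W ω‖ₑ ^ 3 ∂P) ^ (1 / 2 : ℝ) := by
  have hlam := h.lam_pos
  refine iSup₂_le fun f hf =>
    (ENNReal.ofReal_le_ofReal (h.abs_integral_sub_le hk hT hf)).trans_eq ?_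
  have he0 : 0 ≤ ∫ ω, √(∑ i, ∑ j, E i j ω ^ 2) ∂P := integral_nonneg fun _ => by positivity
  rw [lintegral_enorm_pow_eq_ofReal hT, ← ofReal_integral_eq_lintegral_ofReal
    h.integrable_sqrt_error (ae_of_all _ fun _ => by positivity)]
  set T := ∫ ω, ‖W' ω - W ω‖ ^ 3 ∂P with hTd
  have hT0 : 0 ≤ T := integral_nonneg fun _ => by positivity
  rw [ENNReal.ofReal_add (by positivity) (by positivity), ENNReal.ofReal_mul (by positivity)]
  congr 1
  rw [← ENNReal.ofReal_mul (by positivity), ENNReal.ofReal_rpow_of_nonneg (by positivity)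
    (by norm_num), ← ENNReal.ofReal_natCast, ENNReal.ofReal_rpow_of_nonneg (by positivity)
    (by norm_num), ← ENNReal.ofReal_mul (by positivity), ← Real.sqrt_eq_rpow]
  congr 1
  have h4 : (k : ℝ) ^ (1 / 4 : ℝ) = √√k := by
    rw [Real.sqrt_eq_rpow, Real.sqrt_eq_rpow, ← Real.rpow_mul (by positivity)]
    norm_num
  rw [h4, ← Real.sqrt_mul (by positivity)]
  congr 1
  field_simp

/-- The extended real form of `IsSteinPair.abs_measureReal_sub_le`, at the best scale `s`. -/
lemma IsSteinPair.totalVariationDist_le (h : IsSteinPair P W W' lam E) (hk : 0 < k)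
    (hT : Integrable (fun ω => ‖W' ω - W ω‖ ^ 3) P) (hlc : IsLogConcaveMeasure (P.map W)) :
    totalVariationDist (P.map W) (stdGaussian (EuclideanSpace ℝ (Fin k)))
      ≤ ENNReal.ofReal 450
        * (ENNReal.ofReal (k / lam) * ∫⁻ ω, ENNReal.ofReal √(∑ i, ∑ j, E i j ω ^ 2) ∂P
          + ENNReal.ofReal (k ^ 2 / lam) * ∫⁻ ω, ‖W' ω - W ω‖ₑ ^ 3 ∂P) ^ (1 / 3 : ℝ) := by
  have hlam := h.lam_pos
  have he0 : 0 ≤ ∫ ω, √(∑ i, ∑ j, E i j ω ^ 2) ∂P := integral_nonneg fun _ => by positivity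
  have hT0 : 0 ≤ ∫ ω, ‖W' ω - W ω‖ ^ 3 ∂P := integral_nonneg fun _ => by positivity
  rw [lintegral_enorm_pow_eq_ofReal hT, ← ofReal_integral_eq_lintegral_ofReal
    h.integrable_sqrt_error (ae_of_all _ fun _ => by positivity), ← ENNReal.ofReal_mul
    (by positivity), ← ENNReal.ofReal_mul (by positivity), ← ENNReal.ofReal_add (by positivity)
    (by positivity), ENNReal.ofReal_rpow_of_nonneg (by positivity) (by norm_num),
    show (450 : ℝ) = 2 * 225 by norm_num, ENNReal.ofReal_mul zero_le_two, ENNReal.ofReal_ofNat,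
    mul_assoc, ← ENNReal.ofReal_mul (by norm_num), totalVariationDist]
  gcongr
  refine iSup₂_le fun S hS => ENNReal.ofReal_le_ofReal ?_
  set D := k / lam * ∫ ω, √(∑ i, ∑ j, E i j ω ^ 2) ∂P +
    k ^ 2 / lam * ∫ ω, ‖W' ω - W ω‖ ^ 3 ∂P with hD
  have hD0 : 0 ≤ D := by positivity
  rw [← div_le_iff₀' (by norm_num)]
  -- The optimal scale may be `0`, so it is approached from above.
  refine le_of_forall_gt_imp_ge_of_dense fun s hs => ?_
  have hs0 : 0 < s := (Real.rpow_nonneg hD0 _).trans_lt hs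
  rw [div_le_iff₀' (by norm_num)]
  refine h.abs_measureReal_sub_le hk hT hlc hs0 ?_ hS
  calc _ = D := by rw [hD]; ring
    _ = (D ^ (1 / 3 : ℝ)) ^ 3 := by
        rw [← Real.rpow_natCast, ← Real.rpow_mul hD0]
        norm_num
    _ ≤ s ^ 3 := by gcongr

end Distances

theorem mainTheorem4 :
    ∃ C : ℝ, 0 < C ∧
      ∀ (k : ℕ) {Ω : Type*} [MeasurableSpace Ω] (P : Measure Ω) [IsProbabilityMeasure P]
        (W W' : Ω → EuclideanSpace ℝ (Fin k)) (lam : ℝ) (E : Fin k → Fin k → Ω → ℝ),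
        Measurable W → Measurable W' →
        IdentDistrib W W' P P →
        MemLp (fun ω => W' ω - W ω) 2 P →
        0 < lam →
        (∀ i, P[fun ω => W' ω i - W ω i | MeasurableSpace.comap W inferInstance]
          =ᵐ[P] fun ω => -lam * W ω i) →
        (∀ i j, P[fun ω => (W' ω i - W ω i) * (W' ω j - W ω j) |
            MeasurableSpace.comap W inferInstance]
          =ᵐ[P] fun ω => 2 * lam * (if i = j then 1 else 0) + E i j ω) →
        wassersteinDist (P.map W) (stdGaussian (EuclideanSpace ℝ (Fin k)))
            ≤ ENNReal.ofReal (1 / lam) * ∫⁻ ω, ENNReal.ofReal √(∑ i, ∑ j, E i j ω ^ 2) ∂P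
              + (k : ℝ≥0∞) ^ (1 / 4 : ℝ)
                * (ENNReal.ofReal (2 / (3 * lam)) * ∫⁻ ω, ‖W' ω - W ω‖ₑ ^ 3 ∂P) ^ (1 / 2 : ℝ)
        ∧ (IsLogConcaveMeasure (P.map W) →
          totalVariationDist (P.map W) (stdGaussian (EuclideanSpace ℝ (Fin k)))
            ≤ ENNReal.ofReal C
              * (ENNReal.ofReal (k / lam) * ∫⁻ ω, ENNReal.ofReal √(∑ i, ∑ j, E i j ω ^ 2) ∂P
                + ENNReal.ofReal (k ^ 2 / lam) * ∫⁻ ω, ‖W' ω - W ω‖ₑ ^ 3 ∂P) ^ (1 / 3 : ℝ)) := by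

  refine ⟨450, by norm_num, ?_⟩
  intro k Ω _ P _ W W' lam E hW hW' hid hL2 hlam h1 h2
  have h : IsSteinPair P W W' lam E := ⟨hW, hW', hid, hL2, hlam, h1, h2⟩
  have : IsProbabilityMeasure (P.map W) := Measure.isProbabilityMeasure_map hW.aemeasurable
  -- In dimension `0` there is only one probability measure.
  rcases Nat.eq_zero_or_pos k with rfl | hk
  · rw [eq_of_subsingleton (P.map W) (stdGaussian (EuclideanSpace ℝ (Fin 0))),
      wassersteinDist_self, totalVariationDist_self]
    exact ⟨zero_le, fun _ => zero_le⟩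
  -- If the third moment is infinite, so are both right-hand sides.
  by_cases hT : ∫⁻ ω, ‖W' ω - W ω‖ₑ ^ 3 ∂P = ∞
  · have hk' : (k : ℝ≥0∞) ^ (1 / 4 : ℝ) ≠ 0 := by simp [ENNReal.rpow_eq_zero_iff, hk.ne']
    have hc : ENNReal.ofReal (2 / (3 * lam)) ≠ 0 := by simpa using by positivity
    have hc' : ENNReal.ofReal (k ^ 2 / lam) ≠ 0 := by simpa using by positivity
    rw [hT, ENNReal.mul_top hc, ENNReal.mul_top hc', add_top,
      ENNReal.top_rpow_of_pos (by norm_num), ENNReal.top_rpow_of_pos (by norm_num),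
      ENNReal.mul_top hk', add_top, ENNReal.mul_top (by simp)]
    exact ⟨le_top, fun _ => le_top⟩
  · have hTi : Integrable (fun ω => ‖W' ω - W ω‖ ^ 3) P := by
      refine ⟨by fun_prop, ?_⟩
      rw [hasFiniteIntegral_iff_enorm, lt_top_iff_ne_top]
      simpa using hT
    exact ⟨h.wassersteinDist_le hk hTi, h.totalVariationDist_le hk hTi⟩
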